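/- Let $k\ge 0$ be an integer. A sublebesgue measure is a measure $f(x)\,dx$ on $[0,1]$ with $f$ measurable and $0\le f\le 1$ (densities are identified when they agree a.e.). For a binary word $w=w_1\cdots w_n$ let $$\rho_w(f)=n!\int_{0\le x_1<\dots<x_n\le 1}g_1(x_1)\cdots g_n(x_n)\,dx_1\cdots dx_n,\qquad g_i=f\text{ if }w_i=1,\quad g_i=1-f\text{ if }w_i=0.$$ Let $\rho(f)=(\rho_0(f),\rho_{10}(f),\rho_{110}(f),\dots,\rho_{1^k0}(f))$, and let $E_W\subset[0,1]^{k+1}$ be the set of all vectors $\rho(f)$ with $f(x)\,dx$ sublebesgue; interior and boundary of $E_W$ are taken in $\mathbb R^{k+1}$. For such $f$ let $F(x)=\int_0^x f$ and let $H=F^{-1}:[0,F(1)]\to[0,1]$ be the (generalized) inverse distribution function. The entropy of $f$ is $\int_0^1 S(f(x))\,dx$, where $S(q)=-q\log q-(1-q)\log(1-q)$. Let $P_k\cong\mathbb R_{<0}\times\mathbb R^{k}$ be the space of real polynomials of degree at most $k$ with negative constant term, topologized by coefficients. Say that $f$ has shape $p\in P_k$ if $H$ is the genuine inverse of a strictly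 increasing $F$, $p<0$ on $[0,F(1)]$, and $$H'(y)=\frac{1}{1-e^{p(y)}}\qquad (0\le y\le F(1)).$$ 1. For every $\delta$ in the interior of $E_W$ there is, up to a.e. equality, exactly one sublebesgue measure that maximizes the entropy among those with $\rho(f)=\delta$, and it has shape $p$ for some $p\in P_k$. 2. For every $p\in P_k$ there is a sublebesgue measure of shape $p$; its density vector $\rho(f)$ depends only on $p$, and the map $\Phi:p\mapsto\rho(f)$ is a homeomorphism from $P_k$ onto the interior of $E_W$. 3. Every point $\delta$ of the boundary of $E_W$ is $\rho(f)$ for exactly one sublebesgue measure $f(x)\,dx$ (up to a.e. equality), and $f$ is a.e. equal to a $\{0,1\}$-valued step function with at most $k/2+1$ (maximal) intervals on which it takes the value $0$; if there are exactly $k/2+1$ of them, then the first and the last step of $f$ are intervals of value $0$. -/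

import Mathlib

open MeasureTheory Set

noncomputable section

namespace PatternDensity

/-- `f` is the density of a sublebesgue measure `f(x) dx` on `[0,1]`. Two such functions describe
the same measure when they agree almost everywhere on `[0,1]`. -/
def IsSublebesgue (f : ℝ → ℝ) : Prop :=
  Measurable f ∧ ∀ x ∈ Icc (0 : ℝ) 1, f x ∈ Icc (0 : ℝ) 1

/-- Equality of the measures `f(x) dx` and `g(x) dx` on `[0,1]`. -/
def SameMeasure (f g : ℝ → ℝ) : Prop :=
  ∀ᵐ x ∂(volume.restrict (Icc (0 : ℝ) 1)), f x = g x

/-- The density of the pattern `w` (letter `1` is `true`, letter `0` is `false`) in `f(x) dx`: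
`n! ∫_{0 ≤ x₁ < ⋯ < xₙ ≤ 1} g₁(x₁) ⋯ gₙ(xₙ)`, with `gᵢ = f` if `wᵢ = 1` and `gᵢ = 1 - f` if
`wᵢ = 0`. -/
def patternDensity {n : ℕ} (w : Fin n → Bool) (f : ℝ → ℝ) : ℝ :=
  (n.factorial : ℝ) *
    ∫ x in {x : Fin n → ℝ | (∀ i, x i ∈ Icc (0 : ℝ) 1) ∧ StrictMono x},
      ∏ i, (if w i = true then f (x i) else 1 - f (x i))

/-- The pattern `1^i 0`, of length `i + 1`. -/
def onesZero (i : ℕ) : Fin (i + 1) → Bool := fun j => decide ((j : ℕ) < i)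

/-- The vector of densities of the patterns `0, 10, 110, …, 1^k 0`. -/
def densities (k : ℕ) (f : ℝ → ℝ) : Fin (k + 1) → ℝ :=
  fun i => patternDensity (onesZero (i : ℕ)) f

/-- The feasible region for the patterns `0, 10, 110, …, 1^k 0`. -/
def feasible (k : ℕ) : Set (Fin (k + 1) → ℝ) :=
  {δ | (∀ i, δ i ∈ Icc (0 : ℝ) 1) ∧ ∃ f, IsSublebesgue f ∧ densities k f = δ}

/-- The entropy `∫₀¹ S(f(x)) dx`, where `S(p) = -p log p - (1 - p) log (1 - p)`. -/
def entropy (f : ℝ → ℝ) : ℝ := ∫ x in (0 : ℝ)..1, Real.binEntropy (f x)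

/-- `f(x) dx` maximizes the entropy among all sublebesgue measures whose densities of
`0, 10, …, 1^k 0` are `δ`. -/
def IsLimitShape (k : ℕ) (δ : Fin (k + 1) → ℝ) (f : ℝ → ℝ) : Prop :=
  IsSublebesgue f ∧ densities k f = δ ∧
    ∀ g, IsSublebesgue g → densities k g = δ → entropy g ≤ entropy f

/-- The distribution function `F(x) = ∫₀ˣ f`. -/
def distrib (f : ℝ → ℝ) (x : ℝ) : ℝ := ∫ t in (0 : ℝ)..x, f t

/-- The inverse distribution function `H = F⁻¹`, defined on `[0, F(1)]`
(the generalized inverse, which is the inverse when `F` is strictly increasing on `[0,1]`). -/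
def invDistrib (f : ℝ → ℝ) (y : ℝ) : ℝ := sInf {x | x ∈ Icc (0 : ℝ) 1 ∧ y ≤ distrib f x}

/-- Real polynomials of degree at most `k` with negative constant term, as coefficient vectors,
with the topology of `ℝ₋ × ℝᵏ`. -/
abbrev NegPoly (k : ℕ) : Type := {a : Fin (k + 1) → ℝ // a 0 < 0}

/-- The value at `y` of the polynomial with coefficients `a`. -/
def NegPoly.eval {k : ℕ} (a : NegPoly k) (y : ℝ) : ℝ := ∑ i, a.1 i * y ^ (i : ℕ)

/-- The inverse distribution function `H` of `f(x) dx` satisfies `H'(y) = 1 / (1 - e^{p(y)})`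
throughout `[0, F(1)]` (one-sided derivatives at the ends), with `p < 0` there. Together with
`H(0) = 0`, the requirement `H(F(1)) = 1` says that `H` has no jumps, so that `H` is the
genuine inverse of `F : [0,1] → [0, F(1)]`. -/
def HasInverseSlope {k : ℕ} (f : ℝ → ℝ) (p : NegPoly k) : Prop :=
  invDistrib f (distrib f 1) = 1 ∧
    ∀ y ∈ Icc 0 (distrib f 1), p.eval y < 0 ∧
      HasDerivWithinAt (invDistrib f) (1 / (1 - Real.exp (p.eval y))) (Icc 0 (distrib f 1)) y

/-- `f(x) dx` is the `{0,1}`-valued step function on `[0,1]` whose maximal intervals of value `0`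
are, from left to right, the `n` intervals from `s i` to `t i`. -/
def IsZeroOneStep (f : ℝ → ℝ) {n : ℕ} (s t : Fin n → ℝ) : Prop :=
  (∀ i, 0 ≤ s i ∧ s i < t i ∧ t i ≤ 1) ∧ (∀ i j, i < j → t i < s j) ∧
    SameMeasure f ((⋃ i, Ico (s i) (t i))ᶜ.indicator 1)

end PatternDensity

end

open PatternDensity

/-!
Let `F` be the distribution function of `f` and `c = F(1)`. Averaging over the order of the first
`i` points gives `ρ_{1^i0}(f) = (i + 1) ∫ F ^ i (1 - f)`. So the densities are rescaled moments of
the image of `(1 - f(x)) dx` under `F`, a measure on `[0, c]` with `c = 1 - ρ_0(f)`, and the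
feasible region is treated as a moment space: its interior consists of the vectors whose moment
functional is positive on nonzero polynomials nonnegative on `[0, c]`.

For the entropy, Gibbs' inequality `S(q) ≤ -u (1 - q) - q log (1 - e^u)` is an equality exactly for
`q = 1 - e^u`. Taking `u = p(F(x))`, `q = f(x)` and integrating, the substitution `y = F(x)` bounds
the entropy of `f` by a dual functional of `p` that depends on `f` only through its densities, with
equality exactly if `f = 1 - e^{p ∘ F}`, that is `H' = 1 / (1 - e^p)`. Over the interior the dual
functional is coercive, and at a minimizer its stationarity says that the measure of shape `p` has
the prescribed densities. Uniqueness of the maximizer makes `Φ` injective, coercivity makes it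
proper, and a proper continuous bijection is a homeomorphism.

At a boundary point some nonzero polynomial `a`, nonnegative on `[0, c]`, has `∫ a(F) (1 - f) = 0`.
Hence `f = 1` except where `F` takes one of the finitely many values at which `a` vanishes.
Interior roots of `a` are multiple, which bounds the number of intervals where `f = 0`, and
Lagrange interpolation recovers their lengths from the densities.
-/

namespace PatternDensity

noncomputable section

open Filter Topology
open scoped BoundedContinuousFunction

section Distribution

theorem integral_comp_mul_of_lipschitzOnWith {F f φ : ℝ → ℝ} {K : NNReal} {a b : ℝ}
    (hF : LipschitzOnWith K F (uIcc a b)) (hderiv : ∀ᵐ t, t ∈ uIcc a b → HasDerivAt F (f t) t)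
    (hφ : Continuous φ) : ∫ t in a..b, φ (F t) * f t = ∫ y in F a..F b, φ y := by
  let Φ : ℝ → ℝ := fun y => ∫ u in F a..y, φ u
  have hΦ : ∀ y, HasDerivAt Φ (φ y) y := fun y => (hφ.integral_hasStrictDerivAt (F a) y).hasDerivAt
  obtain ⟨c, d, himage⟩ : ∃ c d, F '' uIcc a b = Icc c d :=
    ⟨_, _, hF.continuousOn.image_uIcc_eq_Icc⟩
  obtain ⟨C, hC⟩ := isCompact_Icc.exists_bound_of_continuousOn (s := Icc c d) hφ.continuousOn
  have hΦ_lipschitz : LipschitzOnWith C.toNNReal Φ (F '' uIcc a b) := by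
    rw [himage]
    exact (convex_Icc c d).lipschitzOnWith_of_nnnorm_hasDerivWithin_le (𝕜 := ℝ)
      (fun y _ => (hΦ y).hasDerivWithinAt) fun y hy => NNReal.le_toNNReal_of_coe_le (hC y hy)
  have hac : AbsolutelyContinuousOnInterval (Φ ∘ F) a b :=
    (hΦ_lipschitz.comp hF (mapsTo_image F _)).absolutelyContinuousOnInterval
  calc ∫ t in a..b, φ (F t) * f t = ∫ t in a..b, deriv (Φ ∘ F) t := by
        refine intervalIntegral.integral_congr_ae ?_
        filter_upwards [hderiv] with t ht htab
        exact (((hΦ _).comp t (ht (uIoc_subset_uIcc htab))).deriv).symm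
    _ = Φ (F b) - Φ (F a) := hac.integral_deriv_eq_sub
    _ = ∫ y in F a..F b, φ y := by simp [Φ]

variable {f g : ℝ → ℝ}

theorem IsSublebesgue.intervalIntegrable (hf : IsSublebesgue f) {a b : ℝ}
    (ha : a ∈ Icc (0 : ℝ) 1) (hb : b ∈ Icc (0 : ℝ) 1) : IntervalIntegrable f volume a b := by
  have hbound : ∀ᵐ x ∂volume.restrict (Icc (0 : ℝ) 1), ‖f x‖ ≤ 1 := by
    filter_upwards [ae_restrict_mem measurableSet_Icc] with x hx
    rw [Real.norm_of_nonneg (hf.2 x hx).1]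
    exact (hf.2 x hx).2
  exact ((Measure.integrableOn_of_bounded (by simp) hf.1.aestronglyMeasurable hbound).mono_set
    (uIcc_subset_Icc ha hb)).intervalIntegrable

theorem IsSublebesgue.integrableOn (hf : IsSublebesgue f) : IntegrableOn f (Icc 0 1) :=
  (intervalIntegrable_iff_integrableOn_Icc_of_le zero_le_one).1
    (hf.intervalIntegrable (by simp) (by simp))

theorem IsSublebesgue.one_sub (hf : IsSublebesgue f) : IsSublebesgue fun x => 1 - f x :=
  ⟨measurable_const.sub hf.1, fun x hx =>
    ⟨sub_nonneg.2 (hf.2 x hx).2, sub_le_self _ (hf.2 x hx).1⟩⟩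

theorem distrib_zero (f : ℝ → ℝ) : distrib f 0 = 0 := intervalIntegral.integral_same

theorem IsSublebesgue.distrib_sub (hf : IsSublebesgue f) {a b : ℝ}
    (ha : a ∈ Icc (0 : ℝ) 1) (hb : b ∈ Icc (0 : ℝ) 1) :
    distrib f b - distrib f a = ∫ t in a..b, f t :=
  intervalIntegral.integral_interval_sub_left (hf.intervalIntegrable (by simp) hb)
    (hf.intervalIntegrable (by simp) ha)

theorem IsSublebesgue.distrib_mono (hf : IsSublebesgue f) {a b : ℝ}
    (ha : 0 ≤ a) (hab : a ≤ b) (hb : b ≤ 1) : distrib f a ≤ distrib f b := by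
  rw [← sub_nonneg, hf.distrib_sub ⟨ha, hab.trans hb⟩ ⟨ha.trans hab, hb⟩]
  exact intervalIntegral.integral_nonneg hab fun x hx =>
    (hf.2 x ⟨ha.trans hx.1, hx.2.trans hb⟩).1

theorem IsSublebesgue.distrib_sub_le (hf : IsSublebesgue f) {a b : ℝ}
    (ha : 0 ≤ a) (hab : a ≤ b) (hb : b ≤ 1) : distrib f b - distrib f a ≤ b - a := by
  rw [hf.distrib_sub ⟨ha, hab.trans hb⟩ ⟨ha.trans hab, hb⟩]
  simpa using intervalIntegral.integral_mono_on hab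
    (hf.intervalIntegrable ⟨ha, hab.trans hb⟩ ⟨ha.trans hab, hb⟩)
    (intervalIntegrable_const (c := (1 : ℝ)))
    fun x hx => (hf.2 x ⟨ha.trans hx.1, hx.2.trans hb⟩).2

theorem IsSublebesgue.distrib_nonneg (hf : IsSublebesgue f) {x : ℝ} (hx : x ∈ Icc (0 : ℝ) 1) :
    0 ≤ distrib f x := by
  simpa [distrib_zero] using hf.distrib_mono le_rfl hx.1 hx.2

theorem IsSublebesgue.distrib_le_self (hf : IsSublebesgue f) {x : ℝ} (hx : x ∈ Icc (0 : ℝ) 1) :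
    distrib f x ≤ x := by
  simpa [distrib_zero] using hf.distrib_sub_le le_rfl hx.1 hx.2

theorem IsSublebesgue.distrib_mem (hf : IsSublebesgue f) {x : ℝ} (hx : x ∈ Icc (0 : ℝ) 1) :
    distrib f x ∈ Icc 0 (distrib f 1) :=
  ⟨hf.distrib_nonneg hx, hf.distrib_mono hx.1 hx.2 le_rfl⟩

theorem IsSublebesgue.lipschitzOnWith_distrib (hf : IsSublebesgue f) :
    LipschitzOnWith 1 (distrib f) (Icc (0 : ℝ) 1) := by
  refine LipschitzOnWith.of_le_add fun x hx y hy => ?_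
  rcases le_total x y with h | h
  · linarith [hf.distrib_mono hx.1 h hy.2, dist_nonneg (x := x) (y := y)]
  · rw [Real.dist_eq, abs_of_nonneg (by linarith)]
    linarith [hf.distrib_sub_le hy.1 h hx.2]

theorem IsSublebesgue.continuousOn_distrib (hf : IsSublebesgue f) :
    ContinuousOn (distrib f) (Icc (0 : ℝ) 1) := hf.lipschitzOnWith_distrib.continuousOn

theorem IsSublebesgue.ae_hasDerivAt_distrib (hf : IsSublebesgue f) :
    ∀ᵐ x, x ∈ Icc (0 : ℝ) 1 → HasDerivAt (distrib f) (f x) x := by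
  have h := (hf.intervalIntegrable (a := 0) (b := 1) (by simp) (by simp)).ae_hasDerivAt_integral
  filter_upwards [h] with x hx hx1
  exact hx (by rwa [uIcc_of_le zero_le_one]) 0 (by simp)

theorem IsSublebesgue.integral_comp_distrib_mul (hf : IsSublebesgue f) {φ : ℝ → ℝ}
    (hφ : ContinuousOn φ (Icc 0 (distrib f 1))) {x : ℝ} (hx : x ∈ Icc (0 : ℝ) 1) :
    ∫ t in (0 : ℝ)..x, φ (distrib f t) * f t = ∫ y in (0 : ℝ)..distrib f x, φ y := by
  have hc : 0 ≤ distrib f 1 := hf.distrib_nonneg (by simp)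
  have hsub : uIcc 0 x ⊆ Icc (0 : ℝ) 1 := uIcc_subset_Icc (by simp) hx
  let ψ : ℝ → ℝ := IccExtend hc ((Icc 0 (distrib f 1)).domRestrict φ)
  have hψ : Continuous ψ := (continuousOn_iff_continuous_domRestrict.1 hφ).Icc_extend'
  have hψφ : ∀ y ∈ Icc 0 (distrib f 1), ψ y = φ y := fun y hy => IccExtend_of_mem hc _ hy
  calc ∫ t in (0 : ℝ)..x, φ (distrib f t) * f t
      = ∫ t in (0 : ℝ)..x, ψ (distrib f t) * f t :=
        intervalIntegral.integral_congr fun t ht => by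
          simp only [hψφ _ (hf.distrib_mem (hsub ht))]
    _ = ∫ y in distrib f 0..distrib f x, ψ y := by
        refine integral_comp_mul_of_lipschitzOnWith (hf.lipschitzOnWith_distrib.mono hsub) ?_ hψ
        filter_upwards [hf.ae_hasDerivAt_distrib] with t ht htx using ht (hsub htx)
    _ = ∫ y in (0 : ℝ)..distrib f x, φ y := by
        rw [distrib_zero]
        exact intervalIntegral.integral_congr fun y hy => hψφ y
          (uIcc_subset_Icc (left_mem_Icc.2 hc) (hf.distrib_mem hx) hy)

theorem IsSublebesgue.intervalIntegrable_comp_distrib_mul (hf : IsSublebesgue f) {φ : ℝ → ℝ}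
    (hφ : ContinuousOn φ (Icc 0 (distrib f 1))) (hg : IsSublebesgue g) :
    IntervalIntegrable (fun t => φ (distrib f t) * g t) volume 0 1 := by
  refine (hg.intervalIntegrable (by simp) (by simp)).continuousOn_mul ?_
  rw [uIcc_of_le zero_le_one]
  exact hφ.comp hf.continuousOn_distrib fun t ht => hf.distrib_mem ht

end Distribution

section IncreasingTuples

/-- The strictly increasing `n`-tuples with entries in `J`: the domain of integration of a pattern
density when `J = [0, 1]`. -/
def increasingTuples (n : ℕ) (J : Set ℝ) : Set (Fin n → ℝ) := {x | (∀ i, x i ∈ J) ∧ StrictMono x}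

variable {n : ℕ} {J : Set ℝ}

theorem measurableSet_increasingTuples (n : ℕ) (hJ : MeasurableSet J) :
    MeasurableSet (increasingTuples n J) := by
  have h : increasingTuples n J =
      (⋂ i, {x | x i ∈ J}) ∩ ⋂ (i) (j) (_ : i < j), {x | x i < x j} := by
    ext x
    simp only [increasingTuples, StrictMono, mem_ofPred_eq, mem_inter_iff, mem_iInter]
  rw [h]
  exact (MeasurableSet.iInter fun i => measurable_pi_apply i hJ).inter <|
    MeasurableSet.iInter fun i => MeasurableSet.iInter fun j => MeasurableSet.iInter fun _ =>
      measurableSet_lt (measurable_pi_apply i) (measurable_pi_apply j)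

theorem insertNth_last_mem_increasingTuples {t : ℝ} {y : Fin n → ℝ} :
    Fin.insertNth (α := fun _ => ℝ) (Fin.last n) t y ∈ increasingTuples (n + 1) J ↔
      t ∈ J ∧ y ∈ increasingTuples n (J ∩ Iio t) := by
  simp only [increasingTuples, mem_ofPred_eq, Fin.strictMono_insertNth_iff,
    Fin.forall_iff_succAbove (Fin.last n), Fin.insertNth_apply_same,
    Fin.insertNth_apply_succAbove, Fin.castSucc_lt_last, mem_inter_iff, mem_Iio, Fin.last_le_iff,
    Fin.castSucc_ne_last, forall_and, forall_const, false_imp_iff]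
  tauto

theorem integral_eq_integral_insertNth {E : Type*} [NormedAddCommGroup E] [NormedSpace ℝ E]
    (p : Fin (n + 1)) {G : (Fin (n + 1) → ℝ) → E} (hG : Integrable G) :
    ∫ x, G x = ∫ t, ∫ y : Fin n → ℝ, G (Fin.insertNth (α := fun _ => ℝ) p t y) := by
  have e := (volume_preserving_piFinSuccAbove (fun _ : Fin (n + 1) => ℝ) p).symm
  have hint := (e.integrable_comp_emb (MeasurableEquiv.measurableEmbedding _)).2 hG
  rw [← e.integral_comp']
  exact integral_prod _ hint

theorem integrableOn_prod_increasingTuples {g : Fin n → ℝ → ℝ} (hJ : MeasurableSet J)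
    (hg : ∀ i, IntegrableOn (g i) J) :
    IntegrableOn (fun x => ∏ i, g i (x i)) (increasingTuples n J) := by
  have hprod : Integrable fun x : Fin n → ℝ => ∏ i, J.indicator (g i) (x i) :=
    Integrable.fintype_prod_dep fun i => (integrable_indicator_iff hJ).2 (hg i)
  refine hprod.integrableOn.congr_fun (fun x hx => ?_) (measurableSet_increasingTuples n hJ)
  exact Finset.prod_congr rfl fun i _ => indicator_of_mem (hx.1 i) _

theorem setIntegral_increasingTuples_succ {g : Fin (n + 1) → ℝ → ℝ} (hJ : MeasurableSet J)
    (hg : ∀ i, IntegrableOn (g i) J) :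
    ∫ x in increasingTuples (n + 1) J, ∏ i, g i (x i) =
      ∫ t in J, g (Fin.last n) t *
        ∫ y in increasingTuples n (J ∩ Iio t), ∏ i, g i.castSucc (y i) := by
  have hmeas := measurableSet_increasingTuples (n + 1) hJ
  classical
  rw [← integral_indicator hmeas, integral_eq_integral_insertNth (Fin.last n)
    ((integrable_indicator_iff hmeas).2 (integrableOn_prod_increasingTuples hJ hg)),
    ← integral_indicator hJ]
  congr 1 with t
  by_cases ht : t ∈ J
  · rw [indicator_of_mem ht, ← integral_const_mul, ← integral_indicator
      (measurableSet_increasingTuples n (hJ.inter measurableSet_Iio))]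
    congr 1 with y
    simp only [indicator_apply, insertNth_last_mem_increasingTuples, ht, true_and,
      Fin.prod_univ_succAbove _ (Fin.last n), Fin.insertNth_apply_same,
      Fin.insertNth_apply_succAbove]
    simp only [Fin.succAbove_last]
  · simp only [indicator_apply, insertNth_last_mem_increasingTuples, ht, false_and,
      if_false, integral_zero]

variable {f : ℝ → ℝ}

theorem IsSublebesgue.setIntegral_increasingTuples_Ico (hf : IsSublebesgue f) (n : ℕ) {t : ℝ}
    (ht : t ∈ Icc (0 : ℝ) 1) :
    ∫ x in increasingTuples n (Ico 0 t), ∏ i, f (x i) = distrib f t ^ n / n.factorial := by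
  induction n generalizing t with
  | zero =>
    have huniv : increasingTuples 0 (Ico 0 t) = univ := by
      ext x; simp [increasingTuples, Subsingleton.strictMono]
    simp [huniv, Measure.real, Measure.volume_pi_eq_dirac (0 : Fin 0 → ℝ)]
  | succ n ih =>
    have hint : IntegrableOn f (Ico 0 t) :=
      hf.integrableOn.mono_set (Ico_subset_Icc_self.trans (Icc_subset_Icc_right ht.2))
    have hinner : ∀ s ∈ Ico 0 t, f s * ∫ x in increasingTuples n (Ico 0 t ∩ Iio s), ∏ i, f (x i) =
        (n.factorial : ℝ)⁻¹ * (distrib f s ^ n * f s) := fun s hs => by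
      rw [Ico_inter_Iio, min_eq_right hs.2.le, ih ⟨hs.1, hs.2.le.trans ht.2⟩]
      ring
    rw [setIntegral_increasingTuples_succ measurableSet_Ico fun _ => hint,
      setIntegral_congr_fun measurableSet_Ico hinner, integral_const_mul,
      ← integral_Icc_eq_integral_Ico, integral_Icc_eq_integral_Ioc,
      ← intervalIntegral.integral_of_le ht.1,
      hf.integral_comp_distrib_mul (φ := (· ^ n)) (by fun_prop) ht, integral_pow,
      Nat.factorial_succ, Nat.cast_mul, Nat.cast_succ, zero_pow n.succ_ne_zero, sub_zero]
    field_simp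

theorem IsSublebesgue.densities_eq (hf : IsSublebesgue f) {k : ℕ} (i : Fin (k + 1)) :
    densities k f i = ((i : ℕ) + 1) * ∫ x in (0 : ℝ)..1, distrib f x ^ (i : ℕ) * (1 - f x) := by
  obtain ⟨n, hn⟩ := i
  let g : Fin (n + 1) → ℝ → ℝ := fun j => if onesZero n j = true then f else fun x => 1 - f x
  have hg : ∀ j, IntegrableOn (g j) (Icc 0 1) := fun j => by
    simp only [g]; split_ifs
    exacts [hf.integrableOn, hf.one_sub.integrableOn]
  have hg_castSucc : ∀ j : Fin n, g j.castSucc = f := fun j => by simp [g, onesZero]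
  have hg_last : g (Fin.last n) = fun x => 1 - f x := by simp [g, onesZero]
  have hinner : ∀ t ∈ Icc (0 : ℝ) 1, g (Fin.last n) t *
      ∫ y in increasingTuples n (Icc 0 1 ∩ Iio t), ∏ j : Fin n, g j.castSucc (y j) =
      (n.factorial : ℝ)⁻¹ * (distrib f t ^ n * (1 - f t)) := fun t ht => by
    have hinter : Icc 0 1 ∩ Iio t = Ico 0 t := by
      ext x; exact ⟨fun h => ⟨h.1.1, h.2⟩, fun h => ⟨⟨h.1, h.2.le.trans ht.2⟩, h.2⟩⟩
    simp only [hg_castSucc, hg_last, hinter, hf.setIntegral_increasingTuples_Ico n ht]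
    ring
  have hprod : ∀ x : Fin (n + 1) → ℝ,
      (∏ j, if onesZero n j = true then f (x j) else 1 - f (x j)) = ∏ j, g j (x j) := fun x =>
    Finset.prod_congr rfl fun j _ => by simp only [g]; split_ifs <;> rfl
  calc densities k f ⟨n, hn⟩
      = (n + 1).factorial * ∫ x in increasingTuples (n + 1) (Icc 0 1), ∏ j, g j (x j) := by
        simp only [densities, patternDensity, hprod, increasingTuples]
    _ = (n + 1) * ∫ x in (0 : ℝ)..1, distrib f x ^ n * (1 - f x) := by
        rw [setIntegral_increasingTuples_succ measurableSet_Icc hg,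
          setIntegral_congr_fun measurableSet_Icc hinner, integral_const_mul,
          integral_Icc_eq_integral_Ioc, ← intervalIntegral.integral_of_le zero_le_one,
          Nat.factorial_succ]
        push_cast
        field_simp

end IncreasingTuples

section Compactness

variable {f g h : ℝ → ℝ} {k : ℕ}

theorem SameMeasure.symm (hfg : SameMeasure f g) : SameMeasure g f := by
  filter_upwards [hfg] with x hx using hx.symm

theorem SameMeasure.trans (hfg : SameMeasure f g) (hgh : SameMeasure g h) : SameMeasure f h := by
  filter_upwards [hfg, hgh] with x hx hx' using hx.trans hx'

theorem sameMeasure_of_distrib_eq (hf : IsSublebesgue f) (hg : IsSublebesgue g)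
    (hfg : ∀ x ∈ Icc (0 : ℝ) 1, distrib f x = distrib g x) : SameMeasure f g := by
  have hne (z : ℝ) : ∀ᵐ x : ℝ, x ≠ z := by simp [ae_iff]
  rw [SameMeasure, ae_restrict_iff' measurableSet_Icc]
  filter_upwards [hf.ae_hasDerivAt_distrib, hg.ae_hasDerivAt_distrib, hne 0, hne 1]
    with x hfx hgx hx0 hx1 hx
  refine (hfx hx).unique ((hgx hx).congr_of_eventuallyEq ?_)
  filter_upwards [Ioo_mem_nhds (hx.1.lt_of_ne hx0.symm) (hx.2.lt_of_ne hx1)] with y hy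
    using hfg y (Ioo_subset_Icc_self hy)

theorem exists_distrib_eq {F : ℝ → ℝ} (hmono : Monotone F) (hlip : LipschitzWith 1 F)
    (h0 : F 0 = 0) : ∃ f, IsSublebesgue f ∧ distrib f = F := by
  refine ⟨deriv F, ⟨measurable_deriv F, fun x _ => ⟨hmono.deriv_nonneg, ?_⟩⟩, funext fun x => ?_⟩
  · exact (le_abs_self _).trans (by simpa using norm_deriv_le_of_lipschitz (x₀ := x) hlip)
  · rw [distrib, hlip.lipschitzOnWith.absolutelyContinuousOnInterval.integral_deriv_eq_sub, h0,
      sub_zero]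

theorem IsSublebesgue.densities_eq_sub (hf : IsSublebesgue f) (i : Fin (k + 1)) :
    densities k f i = ((i : ℕ) + 1) * (∫ x in (0 : ℝ)..1, distrib f x ^ (i : ℕ)) -
      distrib f 1 ^ ((i : ℕ) + 1) := by
  have hpow : IntervalIntegrable (fun x => distrib f x ^ (i : ℕ)) volume 0 1 :=
    ContinuousOn.intervalIntegrable_of_Icc zero_le_one (hf.continuousOn_distrib.pow _)
  have hmul := hf.intervalIntegrable_comp_distrib_mul (φ := (· ^ (i : ℕ))) (by fun_prop) hf
  simp only [hf.densities_eq, mul_sub, mul_one]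
  rw [intervalIntegral.integral_sub hpow hmul, mul_sub,
    hf.integral_comp_distrib_mul (φ := (· ^ (i : ℕ))) (by fun_prop) (by simp), integral_pow,
    zero_pow (Nat.succ_ne_zero _), sub_zero, mul_div_cancel₀ _ (by positivity)]

theorem IsSublebesgue.distrib_one (hf : IsSublebesgue f) (k : ℕ) :
    distrib f 1 = 1 - densities k f 0 := by
  rw [hf.densities_eq_sub]; simp

theorem IsSublebesgue.densities_mem (hf : IsSublebesgue f) (i : Fin (k + 1)) :
    densities k f i ∈ Icc (0 : ℝ) 1 := by
  have hint := hf.intervalIntegrable_comp_distrib_mul (φ := (· ^ (i : ℕ))) (by fun_prop)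
    hf.one_sub
  have hle : ∀ x ∈ Icc (0 : ℝ) 1, distrib f x ^ (i : ℕ) * (1 - f x) ≤ x ^ (i : ℕ) := fun x hx =>
    (mul_le_of_le_one_right (pow_nonneg (hf.distrib_nonneg hx) _) (hf.one_sub.2 x hx).2).trans
      (pow_le_pow_left₀ (hf.distrib_nonneg hx) (hf.distrib_le_self hx) _)
  rw [hf.densities_eq]
  constructor
  · exact mul_nonneg (by positivity) <| intervalIntegral.integral_nonneg zero_le_one fun x hx =>
      mul_nonneg (pow_nonneg (hf.distrib_nonneg hx) _) (hf.one_sub.2 x hx).1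
  · calc ((i : ℕ) + 1 : ℝ) * ∫ x in (0 : ℝ)..1, distrib f x ^ (i : ℕ) * (1 - f x)
        ≤ ((i : ℕ) + 1 : ℝ) * ∫ x in (0 : ℝ)..1, x ^ (i : ℕ) :=
          mul_le_mul_of_nonneg_left (intervalIntegral.integral_mono_on zero_le_one hint
            ((continuous_pow _).intervalIntegrable _ _) hle) (by positivity)
      _ = 1 := by
          rw [integral_pow, one_pow, zero_pow (Nat.succ_ne_zero _), sub_zero,
            mul_one_div_cancel (by positivity)]

theorem mem_feasible {δ : Fin (k + 1) → ℝ} :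
    δ ∈ feasible k ↔ ∃ f, IsSublebesgue f ∧ densities k f = δ :=
  ⟨fun hδ => hδ.2, fun ⟨f, hf, hd⟩ => ⟨fun i => hd ▸ hf.densities_mem i, f, hf, hd⟩⟩

/-- Restrictions to `[0,1]` of distribution functions of sublebesgue measures, as a subset of
the continuous functions with the topology of uniform convergence. -/
def distribSet : Set (Icc (0 : ℝ) 1 →ᵇ ℝ) :=
  {F | F 0 = 0 ∧ ∀ x y : Icc (0 : ℝ) 1, x ≤ y → 0 ≤ F y - F x ∧ F y - F x ≤ y - x}

theorem lipschitzWith_of_mem_distribSet {F : Icc (0 : ℝ) 1 →ᵇ ℝ} (hF : F ∈ distribSet) :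
    LipschitzWith 1 F := by
  refine LipschitzWith.of_le_add fun x y => ?_
  rcases le_total x y with h | h
  · linarith [(hF.2 x y h).1, dist_nonneg (x := x) (y := y)]
  · rw [Subtype.dist_eq, Real.dist_eq, abs_of_nonneg (sub_nonneg.2 (Subtype.coe_le_coe.2 h))]
    linarith [(hF.2 y x h).2]

theorem isClosed_distribSet : IsClosed distribSet := by
  have heval (x : Icc (0 : ℝ) 1) : Continuous fun F : Icc (0 : ℝ) 1 →ᵇ ℝ => F x :=
    continuous_eval_const x
  simp only [distribSet, ofPred_and, ofPred_forall]
  refine (isClosed_eq (heval 0) continuous_const).inter <| isClosed_iInter fun x =>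
    isClosed_iInter fun y => isClosed_iInter fun _ => ?_
  exact (isClosed_le continuous_const ((heval y).sub (heval x))).inter
    (isClosed_le ((heval y).sub (heval x)) continuous_const)

theorem isCompact_distribSet : IsCompact distribSet := by
  refine BoundedContinuousFunction.arzela_ascoli₂ (Icc (0 : ℝ) 1) isCompact_Icc _
    isClosed_distribSet (fun F x hF => ?_) ?_
  · have h := hF.2 0 x x.2.1
    rw [hF.1, Icc.coe_zero, sub_zero, sub_zero] at h
    exact ⟨h.1, h.2.trans x.2.2⟩
  · exact (LipschitzWith.uniformEquicontinuous _ 1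
      fun F => lipschitzWith_of_mem_distribSet F.2).equicontinuous

/-- The density vector as a function of the distribution function, for which it is continuous
with respect to uniform convergence. -/
def distribDensities (k : ℕ) (F : Icc (0 : ℝ) 1 →ᵇ ℝ) : Fin (k + 1) → ℝ := fun i =>
  ((i : ℕ) + 1) * (∫ x in (0 : ℝ)..1, F (projIcc 0 1 zero_le_one x) ^ (i : ℕ)) -
    F 1 ^ ((i : ℕ) + 1)

theorem continuous_distribDensities (k : ℕ) : Continuous (distribDensities k) := by
  refine continuous_pi fun i => (continuous_const.mul ?_).sub
    ((continuous_eval_const (1 : Icc (0 : ℝ) 1)).pow _)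
  refine intervalIntegral.continuous_parametric_intervalIntegral_of_continuous' ?_ 0 1
  exact (Continuous.eval continuous_fst (continuous_projIcc.comp continuous_snd)).pow _

theorem IsSublebesgue.densities_eq_distribDensities (hf : IsSublebesgue f)
    {F : Icc (0 : ℝ) 1 →ᵇ ℝ} (hfF : ∀ x : Icc (0 : ℝ) 1, distrib f x = F x) :
    densities k f = distribDensities k F := by
  ext i
  rw [hf.densities_eq_sub, distribDensities, ← hfF 1]
  congr 2
  refine intervalIntegral.integral_congr fun x hx => ?_
  rw [uIcc_of_le zero_le_one] at hx
  rw [← hfF, projIcc_of_mem _ hx]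

theorem feasible_eq_image (k : ℕ) : feasible k = distribDensities k '' distribSet := by
  ext δ
  rw [mem_feasible]
  constructor
  · rintro ⟨f, hf, rfl⟩
    let F : Icc (0 : ℝ) 1 →ᵇ ℝ := BoundedContinuousFunction.mkOfCompact
      ⟨fun x => distrib f x, continuousOn_iff_continuous_domRestrict.1 hf.continuousOn_distrib⟩
    refine ⟨F, ⟨distrib_zero f, fun x y hxy => ⟨?_, ?_⟩⟩,
      (hf.densities_eq_distribDensities fun x => rfl).symm⟩
    · exact sub_nonneg.2 (hf.distrib_mono x.2.1 hxy y.2.2)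
    · exact hf.distrib_sub_le x.2.1 hxy y.2.2
  · rintro ⟨F, hF, rfl⟩
    obtain ⟨f, hf, hfF⟩ := exists_distrib_eq (F := fun x => F (projIcc 0 1 zero_le_one x))
      (fun x y hxy => sub_nonneg.1 (hF.2 _ _ (monotone_projIcc _ hxy)).1)
      (by simpa [Function.comp_def] using
        (lipschitzWith_of_mem_distribSet hF).comp (LipschitzWith.projIcc zero_le_one))
      (by rw [projIcc_left]; exact hF.1)
    exact ⟨f, hf, hf.densities_eq_distribDensities fun x => by simp only [hfF, projIcc_val]⟩

theorem isClosed_feasible (k : ℕ) : IsClosed (feasible k) := by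
  rw [feasible_eq_image]
  exact (isCompact_distribSet.image (continuous_distribDensities k)).isClosed

end Compactness

section Moments

variable {k : ℕ}

/-- The value at `y` of the polynomial with coefficients `a`, as in `NegPoly.eval` but without
sign condition. -/
def polyVal (a : Fin (k + 1) → ℝ) (y : ℝ) : ℝ := dotProduct a fun i => y ^ (i : ℕ)

/-- The linear functional on polynomials sending `y ^ i` to `δ i / (i + 1)`. For the density
vector `δ` of `f` it is integration against the image of `(1 - f(x)) dx` under the distribution
function, see `IsSublebesgue.integral_polyVal`. -/
def momentFun (δ a : Fin (k + 1) → ℝ) : ℝ := dotProduct a fun i => δ i / ((i : ℕ) + 1)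

theorem continuous_polyVal : Continuous fun q : (Fin (k + 1) → ℝ) × ℝ => polyVal q.1 q.2 := by
  unfold polyVal dotProduct; fun_prop

theorem continuous_polyVal_right (a : Fin (k + 1) → ℝ) : Continuous (polyVal a) :=
  continuous_polyVal.comp (.prodMk_right a)

theorem continuous_momentFun :
    Continuous fun q : (Fin (k + 1) → ℝ) × (Fin (k + 1) → ℝ) => momentFun q.1 q.2 := by
  unfold momentFun dotProduct; fun_prop

theorem polyVal_zero_right (a : Fin (k + 1) → ℝ) : polyVal a 0 = a 0 := by
  simp [polyVal, dotProduct, Fin.sum_univ_succ]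

theorem polyVal_add (a b : Fin (k + 1) → ℝ) (y : ℝ) :
    polyVal (a + b) y = polyVal a y + polyVal b y := add_dotProduct _ _ _

theorem polyVal_smul (t : ℝ) (a : Fin (k + 1) → ℝ) (y : ℝ) :
    polyVal (t • a) y = t * polyVal a y := smul_dotProduct _ _ _

theorem polyVal_neg (a : Fin (k + 1) → ℝ) (y : ℝ) : polyVal (-a) y = -polyVal a y :=
  neg_dotProduct _ _

theorem polyVal_single (i : Fin (k + 1)) (t y : ℝ) :
    polyVal (Pi.single i t) y = t * y ^ (i : ℕ) := single_dotProduct _ _ _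

theorem momentFun_add (δ a b : Fin (k + 1) → ℝ) :
    momentFun δ (a + b) = momentFun δ a + momentFun δ b := add_dotProduct _ _ _

theorem momentFun_smul (δ : Fin (k + 1) → ℝ) (t : ℝ) (a : Fin (k + 1) → ℝ) :
    momentFun δ (t • a) = t * momentFun δ a := smul_dotProduct _ _ _

theorem momentFun_neg (δ a : Fin (k + 1) → ℝ) : momentFun δ (-a) = -momentFun δ a :=
  neg_dotProduct _ _

theorem momentFun_single (δ : Fin (k + 1) → ℝ) (i : Fin (k + 1)) (t : ℝ) :
    momentFun δ (Pi.single i t) = t * (δ i / ((i : ℕ) + 1)) := single_dotProduct _ _ _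

theorem integral_polyVal_comp_mul (a : Fin (k + 1) → ℝ) {φ w : ℝ → ℝ} {s t : ℝ}
    (hint : ∀ i : Fin (k + 1), IntervalIntegrable (fun x => φ x ^ (i : ℕ) * w x) volume s t) :
    ∫ x in s..t, polyVal a (φ x) * w x =
      dotProduct a fun i => ∫ x in s..t, φ x ^ (i : ℕ) * w x := by
  simp only [polyVal, dotProduct, Finset.sum_mul, mul_assoc]
  rw [intervalIntegral.integral_finsetSum fun i _ => (hint i).const_mul _]
  simp only [intervalIntegral.integral_const_mul]

theorem IsSublebesgue.integral_polyVal {f : ℝ → ℝ} (hf : IsSublebesgue f)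
    (a : Fin (k + 1) → ℝ) :
    ∫ x in (0 : ℝ)..1, polyVal a (distrib f x) * (1 - f x) = momentFun (densities k f) a := by
  rw [integral_polyVal_comp_mul a fun i => hf.intervalIntegrable_comp_distrib_mul
    (φ := (· ^ (i : ℕ))) (by fun_prop) hf.one_sub, momentFun]
  congr 1 with i
  rw [hf.densities_eq, mul_div_cancel_left₀ _ (by positivity)]

end Moments

section Bose

/-- The Bose function `exp u / (1 - exp u)`, the derivative of `-log (1 - exp u)`. A measure of
shape `p` has `H' = 1 + bose ∘ p`. -/
def bose (u : ℝ) : ℝ := Real.exp u / (1 - Real.exp u)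

variable {u v : ℝ}

theorem one_sub_exp_pos (hu : u < 0) : 0 < 1 - Real.exp u :=
  sub_pos.2 (Real.exp_lt_one_iff.2 hu)

theorem bose_pos (hu : u < 0) : 0 < bose u := div_pos (Real.exp_pos u) (one_sub_exp_pos hu)

theorem one_add_bose (hu : u < 0) : 1 + bose u = 1 / (1 - Real.exp u) := by
  rw [bose, one_add_div (one_sub_exp_pos hu).ne', sub_add_cancel]

theorem neg_mul_bose_le (hu : u < 0) : -u * bose u ≤ 1 := by
  rw [bose, ← mul_div_assoc, div_le_one (one_sub_exp_pos hu)]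
  have hexp : Real.exp (-u) * Real.exp u = 1 := by
    rw [← Real.exp_add, neg_add_cancel, Real.exp_zero]
  nlinarith [Real.exp_pos u, Real.add_one_le_exp (-u)]

theorem exp_div_neg_le_bose (hu : u < 0) : Real.exp u / -u ≤ bose u :=
  div_le_div_of_nonneg_left (Real.exp_pos u).le (one_sub_exp_pos hu)
    (by linarith [Real.add_one_le_exp u])

theorem continuousOn_bose : ContinuousOn bose (Iio 0) :=
  Real.continuous_exp.continuousOn.div (by fun_prop) fun _ hu => (one_sub_exp_pos hu).ne'

theorem continuousOn_neg_log_one_sub_exp :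
    ContinuousOn (fun u => -Real.log (1 - Real.exp u)) (Iio 0) :=
  (ContinuousOn.log (by fun_prop) fun _ hu => (one_sub_exp_pos hu).ne').neg

theorem neg_log_one_sub_exp_add_bose_mul_le (hu : u < 0) (hv : v < 0) :
    -Real.log (1 - Real.exp u) + bose u * (v - u) ≤ -Real.log (1 - Real.exp v) := by
  have hu' := one_sub_exp_pos hu
  have hv' := one_sub_exp_pos hv
  have hlog := Real.log_le_sub_one_of_pos (div_pos hv' hu')
  have hratio : (1 - Real.exp v) / (1 - Real.exp u) - 1 = bose u * (1 - Real.exp (v - u)) := by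
    rw [bose, Real.exp_sub]
    field_simp
    ring
  rw [Real.log_div hv'.ne' hu'.ne', hratio] at hlog
  nlinarith [Real.add_one_le_exp (v - u), bose_pos hu]

theorem intervalIntegrable_mul_bose_comp {u φ : ℝ → ℝ} {c : ℝ} (hc : 0 ≤ c)
    (hφ : ContinuousOn φ (Icc 0 c)) (hu : ContinuousOn u (Icc 0 c))
    (hneg : ∀ y ∈ Icc 0 c, u y < 0) :
    IntervalIntegrable (fun y => φ y * bose (u y)) volume 0 c :=
  (hφ.mul (continuousOn_bose.comp hu hneg)).intervalIntegrable_of_Icc hc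

theorem intervalIntegrable_bose_comp {u : ℝ → ℝ} {c : ℝ} (hc : 0 ≤ c)
    (hu : ContinuousOn u (Icc 0 c)) (hneg : ∀ y ∈ Icc 0 c, u y < 0) :
    IntervalIntegrable (fun y => bose (u y)) volume 0 c :=
  (continuousOn_bose.comp hu hneg).intervalIntegrable_of_Icc hc

end Bose

section Margin

variable {u : ℝ → ℝ} {K : NNReal} {M c h t z : ℝ}

theorem integral_inv_mul_abs_sub_add_right (hK : K ≠ 0) (ht : 0 < t) (hh : 0 ≤ h) (z : ℝ) :
    ∫ y in z..z + h, (K * |y - z| + t)⁻¹ = Real.log ((K * h + t) / t) / K := by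
  calc ∫ y in z..z + h, (K * |y - z| + t)⁻¹ = ∫ s in 0..h, (K * |s| + t)⁻¹ := by
        rw [intervalIntegral.integral_comp_sub_right (fun s => (K * |s| + t)⁻¹), sub_self,
          add_sub_cancel_left]
    _ = ∫ s in 0..h, (K * s + t)⁻¹ := intervalIntegral.integral_congr fun s hs => by
        simp only [abs_of_nonneg (uIcc_of_le hh ▸ hs : s ∈ Icc 0 h).1]
    _ = Real.log ((K * h + t) / t) / K := by
        rw [intervalIntegral.integral_comp_mul_add (fun s => s⁻¹) (NNReal.coe_ne_zero.2 hK),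
          integral_inv_of_pos (by simpa using ht) (by positivity), mul_zero, zero_add,
          smul_eq_mul, inv_mul_eq_div]

theorem integral_inv_mul_abs_sub_add_left (hK : K ≠ 0) (ht : 0 < t) (hh : 0 ≤ h) (z : ℝ) :
    ∫ y in z - h..z, (K * |y - z| + t)⁻¹ = Real.log ((K * h + t) / t) / K := by
  rw [← integral_inv_mul_abs_sub_add_right hK ht hh (-z), show -z + h = -(z - h) by ring,
    ← intervalIntegral.integral_comp_neg]
  simp only [← neg_sub', abs_neg]

theorem log_div_le_integral_inv_mul_abs_sub_add (hK : K ≠ 0) (ht : 0 < t) (hh : 0 ≤ h)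
    (hc : 2 * h ≤ c) (hz : z ∈ Icc 0 c) :
    Real.log ((K * h + t) / t) / K ≤ ∫ y in (0 : ℝ)..c, (K * |y - z| + t)⁻¹ := by
  have hcont : Continuous fun y : ℝ => (K * |y - z| + t)⁻¹ :=
    Continuous.inv₀ (by fun_prop) fun y => by positivity
  have hsub {l r : ℝ} (hl : 0 ≤ l) (hlr : l ≤ r) (hr : r ≤ c) :
      ∫ y in l..r, (K * |y - z| + t)⁻¹ ≤ ∫ y in (0 : ℝ)..c, (K * |y - z| + t)⁻¹ :=
    intervalIntegral.integral_mono_interval hl hlr hr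
      (Eventually.of_forall fun y => by positivity) (hcont.intervalIntegrable _ _)
  rcases le_total z h with hzh | hzh
  · rw [← integral_inv_mul_abs_sub_add_right hK ht hh z]
    exact hsub hz.1 (by linarith) (by linarith)
  · rw [← integral_inv_mul_abs_sub_add_left hK ht hh z]
    exact hsub (by linarith) (by linarith) hz.2

theorem exp_neg_mul_inv_le_bose {s : Set ℝ} {y : ℝ} (hu : LipschitzOnWith K u s) (hy : y ∈ s)
    (hz : z ∈ s) (hMu : -M ≤ u y) (huy : u y < 0) (huz : -t ≤ u z) :
    Real.exp (-M) * (K * |y - z| + t)⁻¹ ≤ bose (u y) := by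
  have hlip : |u y - u z| ≤ K * |y - z| := hu.dist_le_mul y hy z hz
  have hle : -u y ≤ K * |y - z| + t := by linarith [(abs_le.1 hlip).1]
  calc Real.exp (-M) * (K * |y - z| + t)⁻¹ ≤ Real.exp (u y) * (-u y)⁻¹ := by
        gcongr
        · exact inv_nonneg.2 (hle.trans' (neg_pos.2 huy).le)
        · exact neg_pos.2 huy
    _ ≤ bose (u y) := div_eq_mul_inv (Real.exp (u y)) _ ▸ exp_div_neg_le_bose huy

/-- A Lipschitz function `u` nearly vanishing at a point makes `bose ∘ u` nearly as large as
`1 / |y - z|` there, whose integral diverges. -/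
theorem exists_margin (K : NNReal) (M m : ℝ) {c₀ : ℝ} (hc₀ : 0 < c₀) :
    ∃ t > 0, ∀ (c : ℝ) (u : ℝ → ℝ), c₀ ≤ c → LipschitzOnWith K u (Icc 0 c) →
      (∀ y ∈ Icc 0 c, u y ∈ Ico (-M) 0) → ∫ y in (0 : ℝ)..c, bose (u y) ≤ m →
      ∀ y ∈ Icc 0 c, u y ≤ -t := by
  let L : NNReal := K + 1
  have hL : L ≠ 0 := by positivity
  let E : ℝ := m * Real.exp M * L
  let t : ℝ := L * (c₀ / 2) * Real.exp (-E)
  have ht : 0 < t := by positivity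
  have hlog : m < Real.exp (-M) * (Real.log ((L * (c₀ / 2) + t) / t) / L) := by
    have hratio : (L * (c₀ / 2) + t) / t = Real.exp E + 1 := by
      simp only [t, Real.exp_neg]; field_simp
    have hE : E < Real.log (Real.exp E + 1) := by
      rw [Real.lt_log_iff_exp_lt (by positivity)]
      exact lt_add_one _
    calc m = Real.exp (-M) * (E / L) := by simp only [E, Real.exp_neg]; field_simp
      _ < _ := by rw [hratio]; gcongr
  refine ⟨t, ht, fun c u hc hu hMu hint z hz => ?_⟩
  by_contra! hzt
  have hc0 : 0 ≤ c := hc₀.le.trans hc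
  have hbose := intervalIntegrable_bose_comp hc0 hu.continuousOn fun y hy => (hMu y hy).2
  have hcont : Continuous fun y : ℝ => Real.exp (-M) * (L * |y - z| + t)⁻¹ :=
    continuous_const.mul (Continuous.inv₀ (by fun_prop) fun y => by positivity)
  refine hint.not_gt (hlog.trans_le ?_)
  calc Real.exp (-M) * (Real.log ((L * (c₀ / 2) + t) / t) / L)
      ≤ Real.exp (-M) * ∫ y in (0 : ℝ)..c, (L * |y - z| + t)⁻¹ := by
        gcongr
        exact log_div_le_integral_inv_mul_abs_sub_add hL ht (by positivity) (by linarith) hz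
    _ = ∫ y in (0 : ℝ)..c, Real.exp (-M) * (L * |y - z| + t)⁻¹ :=
        (intervalIntegral.integral_const_mul _ _).symm
    _ ≤ ∫ y in (0 : ℝ)..c, bose (u y) :=
        intervalIntegral.integral_mono_on hc0 (hcont.intervalIntegrable _ _) hbose fun y hy =>
          exp_neg_mul_inv_le_bose (hu.weaken le_self_add) hy hz (hMu y hy).1 (hMu y hy).2 hzt.le

end Margin

section Endpoint

/-- `c` is the point where the solution of `H' = 1 / (1 - exp u)`, `H 0 = 0` takes the value `1`,
that is, the total mass of a measure of shape `u`. -/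
structure IsEndpoint (u : ℝ → ℝ) (c : ℝ) : Prop where
  nonneg : 0 ≤ c
  neg : ∀ y ∈ Icc 0 c, u y < 0
  integral_eq : c + ∫ y in (0 : ℝ)..c, bose (u y) = 1

variable {u : ℝ → ℝ} {K : NNReal} {c c' : ℝ}

namespace IsEndpoint

theorem integral_bose (h : IsEndpoint u c) : ∫ y in (0 : ℝ)..c, bose (u y) = 1 - c :=
  eq_sub_of_add_eq' h.integral_eq

theorem pos (h : IsEndpoint u c) : 0 < c := by
  refine h.nonneg.lt_of_ne fun h0 => ?_
  simpa [← h0] using h.integral_eq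

theorem lt_one (h : IsEndpoint u c) (hu : Continuous u) : c < 1 := by
  have hpos : 0 < ∫ y in (0 : ℝ)..c, bose (u y) :=
    intervalIntegral.intervalIntegral_pos_of_pos_on
      (intervalIntegrable_bose_comp h.nonneg hu.continuousOn h.neg)
      (fun y hy => bose_pos (h.neg y (Ioo_subset_Icc_self hy))) h.pos
  linarith [h.integral_eq]

theorem unique (h : IsEndpoint u c) (h' : IsEndpoint u c') (hu : Continuous u) : c = c' := by
  wlog hcc : c ≤ c' generalizing c c'
  · exact (this h' h (le_of_not_ge hcc)).symm
  have hmono : ∫ y in (0 : ℝ)..c, bose (u y) ≤ ∫ y in (0 : ℝ)..c', bose (u y) := by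
    refine intervalIntegral.integral_mono_interval le_rfl h.nonneg hcc ?_
      (intervalIntegrable_bose_comp h'.nonneg hu.continuousOn h'.neg)
    filter_upwards [ae_restrict_mem measurableSet_Ioc] with y hy
      using (bose_pos (h'.neg y (Ioc_subset_Icc_self hy))).le
  linarith [h.integral_eq, h'.integral_eq]

end IsEndpoint

theorem exists_first_nonneg {y : ℝ} (hu : Continuous u) (h0 : u 0 < 0) (hy : 0 ≤ y)
    (huy : 0 ≤ u y) : ∃ z ∈ Ioc 0 y, 0 ≤ u z ∧ ∀ x ∈ Ico 0 z, u x < 0 := by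
  let Z : Set ℝ := Icc 0 y ∩ {x | 0 ≤ u x}
  have hZ : IsCompact Z := isCompact_Icc.inter_right (isClosed_le continuous_const hu)
  obtain ⟨⟨hz0, hzy⟩, huz⟩ : sInf Z ∈ Z := hZ.sInf_mem ⟨y, ⟨hy, le_rfl⟩, huy⟩
  refine ⟨sInf Z, ⟨hz0.lt_of_ne fun hz => ?_, hzy⟩, huz, fun x hx => ?_⟩
  · exact h0.not_ge (hz ▸ huz)
  · by_contra! hux
    exact hx.2.not_ge (csInf_le hZ.bddBelow ⟨⟨hx.1, hx.2.le.trans hzy⟩, hux⟩)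

theorem exists_one_le_add_integral_bose (hu : Continuous u) (hK : LipschitzOnWith K u (Icc 0 1))
    (h0 : u 0 < 0) :
    ∃ z, 0 ≤ z ∧ (∀ y ∈ Icc 0 z, u y < 0) ∧ 1 ≤ z + ∫ y in (0 : ℝ)..z, bose (u y) := by
  by_cases hneg : ∀ y ∈ Icc (0 : ℝ) 1, u y < 0
  · exact ⟨1, zero_le_one, hneg, le_add_of_nonneg_right <|
      intervalIntegral.integral_nonneg zero_le_one fun y hy => (bose_pos (hneg y hy)).le⟩
  push Not at hneg
  obtain ⟨y, hy, huy⟩ := hneg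
  obtain ⟨z, ⟨hz0, hzy⟩, huz, hlt⟩ := exists_first_nonneg hu h0 hy.1 huy
  have hz1 : z ≤ 1 := hzy.trans hy.2
  obtain ⟨B, hB⟩ := isCompact_Icc.exists_bound_of_continuousOn (s := Icc 0 z) hu.continuousOn
  obtain ⟨t, ht, hmargin⟩ := exists_margin K B 1 (half_pos hz0)
  by_contra! hcon
  have hle : ∀ᶠ x in 𝓝[<] z, u x ≤ -t := by
    filter_upwards [Ioo_mem_nhdsLT (half_lt_self hz0)] with x hx
    have hx0 : 0 < x := (half_pos hz0).trans hx.1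
    have hneg : ∀ s ∈ Icc 0 x, u s < 0 := fun s hs => hlt s ⟨hs.1, hs.2.trans_lt hx.2⟩
    refine hmargin x u hx.1.le (hK.mono (Icc_subset_Icc_right (hx.2.le.trans hz1)))
      (fun s hs => ⟨?_, hneg s hs⟩) ?_ x (right_mem_Icc.2 hx0.le)
    · exact neg_le_of_abs_le (hB s ⟨hs.1, hs.2.trans hx.2.le⟩)
    · linarith [hcon x hx0.le hneg]
  have huzt : u z ≤ -t := le_of_tendsto (hu.continuousAt.mono_left nhdsWithin_le_nhds) hle
  linarith

theorem exists_isEndpoint (hu : Continuous u) (hK : LipschitzOnWith K u (Icc 0 1))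
    (h0 : u 0 < 0) : ∃ c, IsEndpoint u c := by
  obtain ⟨z, hz, hneg, hge⟩ := exists_one_le_add_integral_bose hu hK h0
  have hcont : ContinuousOn (fun x => x + ∫ y in (0 : ℝ)..x, bose (u y)) (Icc 0 z) := by
    rw [← uIcc_of_le hz]
    exact continuousOn_id.add <| intervalIntegral.continuousOn_primitive_interval'
      (intervalIntegrable_bose_comp hz hu.continuousOn hneg) left_mem_uIcc
  obtain ⟨c, hc, hc1⟩ := intermediate_value_Icc hz hcont ⟨by simp, hge⟩
  exact ⟨c, hc.1, fun y hy => hneg y ⟨hy.1, hy.2.trans hc.2⟩, hc1⟩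

end Endpoint

section UniformBounds

variable {k : ℕ}

theorem abs_dotProduct_le {ι : Type*} [Fintype ι] (a v : ι → ℝ) :
    |dotProduct a v| ≤ Fintype.card ι * (‖a‖ * ‖v‖) := by
  calc |dotProduct a v| ≤ ∑ i, |a i * v i| := Finset.abs_sum_le_sum_abs _ _
    _ ≤ ∑ _ : ι, ‖a‖ * ‖v‖ := Finset.sum_le_sum fun i _ => by
        rw [abs_mul]
        exact mul_le_mul (norm_le_pi_norm a i) (norm_le_pi_norm v i) (abs_nonneg _) (norm_nonneg _)
    _ = Fintype.card ι * (‖a‖ * ‖v‖) := by simp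

theorem abs_polyVal_le (a : Fin (k + 1) → ℝ) {y : ℝ} (hy : y ∈ Icc (0 : ℝ) 1) :
    |polyVal a y| ≤ (k + 1) * ‖a‖ := by
  have hnorm : ‖fun i : Fin (k + 1) => y ^ (i : ℕ)‖ ≤ 1 :=
    (pi_norm_le_iff_of_nonneg zero_le_one).2 fun i => by
      rw [norm_pow, Real.norm_of_nonneg hy.1]
      exact pow_le_one₀ hy.1 hy.2
  refine (abs_dotProduct_le a _).trans ?_
  rw [Fintype.card_fin, Nat.cast_add_one]
  exact mul_le_mul_of_nonneg_left (mul_le_of_le_one_right (norm_nonneg a) hnorm) (by positivity)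

theorem lipschitzOnWith_polyVal (a : Fin (k + 1) → ℝ) :
    LipschitzOnWith ((k + 1) * (‖a‖₊ * k)) (polyVal a) (Icc 0 1) := by
  refine LipschitzOnWith.of_dist_le_mul fun y hy z hz => ?_
  have hmax : max |y| |z| ≤ 1 := max_le (abs_le.2 ⟨by linarith [hy.1], hy.2⟩)
    (abs_le.2 ⟨by linarith [hz.1], hz.2⟩)
  have hnorm : ‖(fun i : Fin (k + 1) => y ^ (i : ℕ)) - fun i : Fin (k + 1) => z ^ (i : ℕ)‖ ≤
      k * |y - z| :=
    (pi_norm_le_iff_of_nonneg (by positivity)).2 fun i => calc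
      |y ^ (i : ℕ) - z ^ (i : ℕ)| ≤ |y - z| * (i : ℕ) * max |y| |z| ^ ((i : ℕ) - 1) :=
        abs_pow_sub_pow_le y z i
      _ ≤ |y - z| * k * 1 := by
        gcongr
        · exact Nat.lt_succ_iff.1 i.2
        · exact pow_le_one₀ (le_max_of_le_left (abs_nonneg y)) hmax
      _ = k * |y - z| := by ring
  calc dist (polyVal a y) (polyVal a z)
      = |dotProduct a ((fun i : Fin (k + 1) => y ^ (i : ℕ)) -
          fun i : Fin (k + 1) => z ^ (i : ℕ))| := by
        rw [dotProduct_sub, Real.dist_eq]; rfl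
    _ ≤ (k + 1) * (‖a‖ * (k * |y - z|)) := by
        refine (abs_dotProduct_le a _).trans ?_
        rw [Fintype.card_fin, Nat.cast_add_one]
        gcongr
    _ = ((k + 1) * (‖a‖₊ * k) : NNReal) * dist y z := by
        push_cast [Real.dist_eq]; ring

theorem exists_margin_polyVal (k : ℕ) (R m : ℝ) {c₀ : ℝ} (hc₀ : 0 < c₀) :
    ∃ t > 0, ∀ a : Fin (k + 1) → ℝ, ‖a‖ ≤ R → ∀ c ∈ Icc c₀ 1,
      (∀ y ∈ Icc 0 c, polyVal a y < 0) → ∫ y in (0 : ℝ)..c, bose (polyVal a y) ≤ m →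
      ∀ y ∈ Icc 0 c, polyVal a y ≤ -t := by
  obtain ⟨t, ht, hmargin⟩ := exists_margin ((k + 1) * (R.toNNReal * k)) ((k + 1) * R) m hc₀
  refine ⟨t, ht, fun a ha c hc hneg hint => hmargin c _ hc.1 ?_ (fun y hy => ⟨?_, hneg y hy⟩) hint⟩
  · refine ((lipschitzOnWith_polyVal a).mono (Icc_subset_Icc_right hc.2)).weaken ?_
    gcongr
    exact NNReal.le_toNNReal_of_coe_le ha
  · have hle : ((k : ℝ) + 1) * ‖a‖ ≤ (k + 1) * R := by gcongr
    exact neg_le_of_abs_le ((abs_polyVal_le a ⟨hy.1, hy.2.trans hc.2⟩).trans hle)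

end UniformBounds

section MarginSet

variable {k : ℕ} {t : ℝ}

/-- The pairs `(a, c)` such that the polynomial with coefficients `a` is at most `-t` on `[0, c]`:
regions on which integrals over `[0, c]` of functions with a singularity at polynomial value `0`
depend continuously on `(a, c)`. -/
def marginSet (k : ℕ) (t : ℝ) : Set ((Fin (k + 1) → ℝ) × ℝ) :=
  {q | 0 ≤ q.2 ∧ ∀ y ∈ Icc 0 q.2, polyVal q.1 y ≤ -t}

theorem forall_mem_Icc_iff_forall_mul {c : ℝ} (hc : 0 ≤ c) {P : ℝ → Prop} :
    (∀ y ∈ Icc 0 c, P y) ↔ ∀ s ∈ Icc (0 : ℝ) 1, P (c * s) := by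
  have himage : (fun s => c * s) '' Icc 0 1 = Icc 0 c := by
    rw [image_mul_left_Icc hc zero_le_one, mul_zero, mul_one]
  rw [← himage, forall_mem_image]

theorem isClosed_marginSet : IsClosed (marginSet k t) := by
  have h : marginSet k t =
      {q | 0 ≤ q.2} ∩ ⋂ s ∈ Icc (0 : ℝ) 1, {q | polyVal q.1 (q.2 * s) ≤ -t} := by
    ext q
    simp only [marginSet, mem_ofPred_eq, mem_inter_iff, mem_iInter]
    exact and_congr_right fun hq => forall_mem_Icc_iff_forall_mul hq
  rw [h]
  exact (isClosed_le continuous_const continuous_snd).inter <|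
    isClosed_iInter fun s => isClosed_iInter fun _ => isClosed_le
      (continuous_polyVal.comp (continuous_fst.prodMk (continuous_snd.mul continuous_const)))
      continuous_const

/-- Replacing the polynomial by its minimum with `-t` changes nothing on `marginSet k t` and makes
the integrand jointly continuous. -/
theorem continuousOn_integral_mul_comp_polyVal (ht : 0 < t) {φ ψ : ℝ → ℝ} (hφ : Continuous φ)
    (hψ : ContinuousOn ψ (Iio 0)) :
    ContinuousOn (fun q : (Fin (k + 1) → ℝ) × ℝ => ∫ y in (0 : ℝ)..q.2, φ y * ψ (polyVal q.1 y))
      (marginSet k t) := by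
  have htrunc : Continuous fun u : ℝ => ψ (min u (-t)) :=
    hψ.comp_continuous (by fun_prop) fun u => (min_le_right u (-t)).trans_lt (neg_neg_of_pos ht)
  have hcont : Continuous fun q : (Fin (k + 1) → ℝ) × ℝ =>
      ∫ y in (0 : ℝ)..q.2, φ y * ψ (min (polyVal q.1 y) (-t)) := by
    refine intervalIntegral.continuous_parametric_intervalIntegral_of_continuous
      (f := fun (q : (Fin (k + 1) → ℝ) × ℝ) y => φ y * ψ (min (polyVal q.1 y) (-t)))
      ?_ continuous_snd
    exact (hφ.comp continuous_snd).mul (htrunc.comp (continuous_polyVal.comp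
      ((continuous_fst.comp continuous_fst).prodMk continuous_snd)))
  refine hcont.continuousOn.congr fun q hq => intervalIntegral.integral_congr fun y hy => ?_
  simp only [min_eq_left (hq.2 y (uIcc_of_le hq.1 ▸ hy))]

end MarginSet

section Profile

variable {u : ℝ → ℝ} {f g : ℝ → ℝ} {c : ℝ}

/-- The primitive of `1 / (1 - exp u) = 1 + bose u` vanishing at `0`: the inverse distribution
function of a measure of shape `u`. -/
def profile (u : ℝ → ℝ) (y : ℝ) : ℝ := ∫ s in (0 : ℝ)..y, (1 + bose (u s))

/-- The equation `f = 1 - exp (u ∘ F)`, where `F` is the distribution function of `f`. It says that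
the derivative of `F⁻¹` is `1 / (1 - exp u)`. -/
def IsProfileDensity (u f : ℝ → ℝ) : Prop :=
  SameMeasure f fun x => 1 - Real.exp (u (distrib f x))

theorem profile_zero (u : ℝ → ℝ) : profile u 0 = 0 := intervalIntegral.integral_same

theorem continuousOn_one_add_bose_comp {s : Set ℝ} (hu : ContinuousOn u s)
    (hneg : ∀ y ∈ s, u y < 0) : ContinuousOn (fun y => 1 + bose (u y)) s :=
  continuousOn_const.add (continuousOn_bose.comp hu hneg)

theorem sub_le_profile_sub {a b : ℝ} {s : Set ℝ} (hs : s.OrdConnected) (h0 : 0 ∈ s)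
    (hu : ContinuousOn u s) (hneg : ∀ y ∈ s, u y < 0) (ha : a ∈ s) (hb : b ∈ s) (hab : a ≤ b) :
    b - a ≤ profile u b - profile u a := by
  have hint {x y : ℝ} (hx : x ∈ s) (hy : y ∈ s) :
      IntervalIntegrable (fun y => 1 + bose (u y)) volume x y :=
    ((continuousOn_one_add_bose_comp hu hneg).mono (hs.uIcc_subset hx hy)).intervalIntegrable
  rw [profile, profile, intervalIntegral.integral_interval_sub_left (hint h0 hb) (hint h0 ha)]
  simpa using intervalIntegral.integral_mono_on hab (intervalIntegrable_const (c := (1 : ℝ)))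
    (hint ha hb) fun y hy => le_add_of_nonneg_right (bose_pos (hneg y (hs.out ha hb hy))).le

theorem strictMonoOn_profile {s : Set ℝ} (hs : s.OrdConnected) (h0 : 0 ∈ s)
    (hu : ContinuousOn u s) (hneg : ∀ y ∈ s, u y < 0) : StrictMonoOn (profile u) s :=
  fun _ ha _ hb hab => sub_pos.1 <|
    (sub_pos.2 hab).trans_le (sub_le_profile_sub hs h0 hu hneg ha hb hab.le)

theorem hasDerivAt_profile (hu : Continuous u) (hneg : ∀ y, u y < 0) (y : ℝ) :
    HasDerivAt (profile u) (1 + bose (u y)) y :=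
  ((continuousOn_univ.1 (continuousOn_one_add_bose_comp hu.continuousOn fun y _ =>
    hneg y)).integral_hasStrictDerivAt 0 y).hasDerivAt

theorem hasDerivWithinAt_profile (hu : ContinuousOn u (Icc 0 c)) (hneg : ∀ y ∈ Icc 0 c, u y < 0)
    {y : ℝ} (hy : y ∈ Icc 0 c) :
    HasDerivWithinAt (profile u) (1 + bose (u y)) (Icc 0 c) y := by
  have hcont := continuousOn_one_add_bose_comp hu hneg
  have : Fact (y ∈ Icc 0 c) := ⟨hy⟩
  exact intervalIntegral.integral_hasDerivWithinAt_right
    ((hcont.mono (Icc_subset_Icc_right hy.2)).intervalIntegrable_of_Icc hy.1)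
    (hcont.stronglyMeasurableAtFilter_nhdsWithin measurableSet_Icc y) (hcont y hy)

theorem tendsto_profile_atTop_atBot (hu : Continuous u) (hneg : ∀ y, u y < 0) :
    Tendsto (profile u) atTop atTop ∧ Tendsto (profile u) atBot atBot := by
  have hle {a b : ℝ} (hab : a ≤ b) : b - a ≤ profile u b - profile u a :=
    sub_le_profile_sub ordConnected_univ (mem_univ 0) hu.continuousOn (fun y _ => hneg y)
      (mem_univ a) (mem_univ b) hab
  constructor
  · refine tendsto_atTop_mono' _ ?_ tendsto_id
    filter_upwards [eventually_ge_atTop 0] with y hy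
    simpa [profile_zero] using hle hy
  · refine tendsto_atBot_mono' _ ?_ tendsto_id
    filter_upwards [eventually_le_atBot 0] with y hy
    simpa [profile_zero] using hle hy

theorem exists_profile_rightInverse (hu : Continuous u) (hneg : ∀ y, u y < 0) :
    ∃ F : ℝ → ℝ, Monotone F ∧ (∀ y, F (profile u y) = y) ∧
      ∀ x, HasDerivAt F (1 - Real.exp (u (F x))) x := by
  have hderiv := hasDerivAt_profile hu hneg
  have hcont : Continuous (profile u) :=
    continuous_iff_continuousAt.2 fun y => (hderiv y).continuousAt
  have hmono : StrictMono (profile u) := strictMonoOn_univ.1 <|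
    strictMonoOn_profile ordConnected_univ (mem_univ 0) hu.continuousOn fun y _ => hneg y
  obtain ⟨htop, hbot⟩ := tendsto_profile_atTop_atBot hu hneg
  let e := hmono.orderIsoOfSurjective _ (hcont.surjective htop hbot)
  refine ⟨e.symm, e.symm.monotone, e.symm_apply_apply, fun x => ?_⟩
  have hinv := HasDerivAt.of_local_left_inverse e.symm.continuous.continuousAt (hderiv _)
    (add_pos one_pos (bose_pos (hneg (e.symm x)))).ne' (Eventually.of_forall e.apply_symm_apply)
  rwa [one_add_bose (hneg _), one_div, inv_inv] at hinv

theorem IsEndpoint.profile_eq_one (h : IsEndpoint u c) (hu : Continuous u) : profile u c = 1 := by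
  rw [profile, intervalIntegral.integral_add intervalIntegrable_const
    (intervalIntegrable_bose_comp h.nonneg hu.continuousOn h.neg)]
  simpa using h.integral_eq

theorem IsEndpoint.exists_isProfileDensity (h : IsEndpoint u c) (hu : Continuous u) :
    ∃ f, IsSublebesgue f ∧ distrib f 1 = c ∧ IsProfileDensity u f := by
  let v : ℝ → ℝ := fun y => u (projIcc 0 c h.nonneg y)
  have hv : Continuous v := hu.comp (continuous_subtype_val.comp continuous_projIcc)
  have hvneg (y : ℝ) : v y < 0 := h.neg _ (projIcc 0 c h.nonneg y).2
  have hvu {y : ℝ} (hy : y ∈ Icc 0 c) : v y = u y := by simp only [v, projIcc_of_mem h.nonneg hy]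
  obtain ⟨F, hmono, hinv, hderiv⟩ := exists_profile_rightInverse hv hvneg
  have hF0 : F 0 = 0 := by simpa [profile_zero] using hinv 0
  have hprofile : profile v c = profile u c := intervalIntegral.integral_congr fun y hy => by
    simp only [hvu (uIcc_of_le h.nonneg ▸ hy)]
  have hF1 : F 1 = c := by rw [← hinv c, hprofile, h.profile_eq_one hu]
  have hF : Continuous F := continuous_iff_continuousAt.2 fun x => (hderiv x).continuousAt
  have hf : Continuous fun x => 1 - Real.exp (v (F x)) := by fun_prop
  have hdistrib (x : ℝ) : distrib (fun x => 1 - Real.exp (v (F x))) x = F x := by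
    rw [distrib, intervalIntegral.integral_eq_sub_of_hasDerivAt (fun y _ => hderiv y)
      (hf.intervalIntegrable _ _), hF0, sub_zero]
  refine ⟨_, ⟨hf.measurable, fun x _ => ⟨(one_sub_exp_pos (hvneg _)).le,
    sub_le_self _ (Real.exp_pos _).le⟩⟩, (hdistrib 1).trans hF1, ?_⟩
  filter_upwards [ae_restrict_mem measurableSet_Icc] with x hx
  rw [hdistrib, hvu ⟨hF0 ▸ hmono hx.1, hF1 ▸ hmono hx.2⟩]

theorem IsSublebesgue.profile_distrib (hf : IsSublebesgue f) (hu : Continuous u)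
    (hneg : ∀ y ∈ Icc 0 (distrib f 1), u y < 0) (hfu : IsProfileDensity u f) {x : ℝ}
    (hx : x ∈ Icc (0 : ℝ) 1) : profile u (distrib f x) = x := by
  rw [profile, ← hf.integral_comp_distrib_mul
    (continuousOn_one_add_bose_comp hu.continuousOn hneg) hx]
  calc ∫ t in (0 : ℝ)..x, (1 + bose (u (distrib f t))) * f t = ∫ _ in (0 : ℝ)..x, 1 := by
        refine intervalIntegral.integral_congr_ae ?_
        filter_upwards [(ae_restrict_iff' measurableSet_Icc).1 hfu] with t ht htx
        rw [uIoc_of_le hx.1] at htx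
        have ht1 : t ∈ Icc (0 : ℝ) 1 := ⟨htx.1.le, htx.2.trans hx.2⟩
        have hneg' := hneg _ (hf.distrib_mem ht1)
        rw [ht ht1, one_add_bose hneg', one_div_mul_cancel (one_sub_exp_pos hneg').ne']
    _ = x := by simp

theorem IsEndpoint.sameMeasure_of_isProfileDensity (h : IsEndpoint u c) (hu : Continuous u)
    (hf : IsSublebesgue f) (hg : IsSublebesgue g) (hfc : distrib f 1 = c)
    (hgc : distrib g 1 = c) (hfu : IsProfileDensity u f) (hgu : IsProfileDensity u g) :
    SameMeasure f g := by
  refine sameMeasure_of_distrib_eq hf hg fun x hx => ?_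
  refine (strictMonoOn_profile ordConnected_Icc (left_mem_Icc.2 h.nonneg) hu.continuousOn
    h.neg).injOn (hfc ▸ hf.distrib_mem hx) (hgc ▸ hg.distrib_mem hx) ?_
  rw [hf.profile_distrib hu (hfc ▸ h.neg) hfu hx, hg.profile_distrib hu (hgc ▸ h.neg) hgu hx]

end Profile

section InverseDistribution

variable {f : ℝ → ℝ}

theorem invDistrib_zero (f : ℝ → ℝ) : invDistrib f 0 = 0 :=
  IsLeast.csInf_eq ⟨⟨by simp, (distrib_zero f).ge⟩, fun _ hx => hx.1.1⟩

theorem IsSublebesgue.exists_distrib_eq (hf : IsSublebesgue f) {y : ℝ}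
    (hy : y ∈ Icc 0 (distrib f 1)) : ∃ x ∈ Icc (0 : ℝ) 1, distrib f x = y :=
  intermediate_value_Icc zero_le_one hf.continuousOn_distrib ((distrib_zero f).symm ▸ hy)

theorem IsSublebesgue.invDistrib_mem (hf : IsSublebesgue f) {y : ℝ}
    (hy : y ∈ Icc 0 (distrib f 1)) :
    invDistrib f y ∈ Icc (0 : ℝ) 1 ∧ y ≤ distrib f (invDistrib f y) :=
  (hf.continuousOn_distrib.preimage_isClosed_of_isClosed isClosed_Icc isClosed_Ici).csInf_mem
    ⟨1, by simp, hy.2⟩ ⟨0, fun _ hx => hx.1.1⟩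

theorem IsSublebesgue.distrib_invDistrib (hf : IsSublebesgue f) {y : ℝ}
    (hy : y ∈ Icc 0 (distrib f 1)) : distrib f (invDistrib f y) = y := by
  obtain ⟨hmem, hle⟩ := hf.invDistrib_mem hy
  obtain ⟨x, hx, rfl⟩ := hf.exists_distrib_eq hy
  exact (hf.distrib_mono hmem.1 (csInf_le ⟨0, fun _ hz => hz.1.1⟩ ⟨hx, le_rfl⟩) hx.2).antisymm hle

end InverseDistribution

section Shape

variable {k : ℕ} {f : ℝ → ℝ} {c : ℝ} {p : NegPoly k}

theorem IsEndpoint.hasInverseSlope (h : IsEndpoint (polyVal p.1) c) (hf : IsSublebesgue f)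
    (hfc : distrib f 1 = c) (hfp : IsProfileDensity (polyVal p.1) f) : HasInverseSlope f p := by
  subst hfc
  have hcont := continuous_polyVal_right p.1
  have hinv {x : ℝ} (hx : x ∈ Icc (0 : ℝ) 1) := hf.profile_distrib hcont h.neg hfp hx
  have heq : ∀ y ∈ Icc 0 (distrib f 1), invDistrib f y = profile (polyVal p.1) y := fun y hy => by
    rw [← hinv (hf.invDistrib_mem hy).1, hf.distrib_invDistrib hy]
  refine ⟨?_, fun y hy => ⟨h.neg y hy, ?_⟩⟩
  · rw [heq _ (right_mem_Icc.2 h.nonneg), h.profile_eq_one hcont]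
  · have hderiv := hasDerivWithinAt_profile hcont.continuousOn h.neg hy
    rw [one_add_bose (h.neg y hy)] at hderiv
    exact hderiv.congr heq (heq y hy)

namespace HasInverseSlope

theorem integral_pow (h : HasInverseSlope f p) (hf : IsSublebesgue f) (n : ℕ) :
    ∫ y in (0 : ℝ)..distrib f 1, y ^ n * (1 + bose (polyVal p.1 y)) =
      ∫ x in (0 : ℝ)..1, distrib f x ^ n := by
  have hc : 0 ≤ distrib f 1 := hf.distrib_nonneg (by simp)
  have hneg : ∀ y ∈ Icc 0 (distrib f 1), polyVal p.1 y < 0 := fun y hy => (h.2 y hy).1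
  have hderiv : ∀ y ∈ Icc 0 (distrib f 1),
      HasDerivWithinAt (invDistrib f) (1 + bose (polyVal p.1 y)) (Icc 0 (distrib f 1)) y :=
    fun y hy => one_add_bose (hneg y hy) ▸ (h.2 y hy).2
  have hIcc : uIcc 0 (distrib f 1) = Icc 0 (distrib f 1) := uIcc_of_le hc
  calc ∫ y in (0 : ℝ)..distrib f 1, y ^ n * (1 + bose (polyVal p.1 y))
      = ∫ y in (0 : ℝ)..distrib f 1,
          ((fun x => distrib f x ^ n) ∘ invDistrib f) y * (1 + bose (polyVal p.1 y)) :=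
        intervalIntegral.integral_congr fun y hy => by
          simp only [Function.comp, hf.distrib_invDistrib (hIcc ▸ hy)]
    _ = ∫ x in invDistrib f 0..invDistrib f (distrib f 1), distrib f x ^ n := by
        refine intervalIntegral.integral_comp_mul_deriv'' ?_ ?_ ?_ ?_
        · exact hIcc ▸ fun y hy => (hderiv y hy).continuousWithinAt
        · rw [min_eq_left hc, max_eq_right hc]
          exact fun y hy => ((hderiv y (Ioo_subset_Icc_self hy)).hasDerivAt
            (Icc_mem_nhds hy.1 hy.2)).hasDerivWithinAt
        · exact hIcc ▸ continuousOn_one_add_bose_comp (continuous_polyVal_right _).continuousOn hneg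
        · refine (hf.continuousOn_distrib.pow n).mono ?_
          rintro _ ⟨y, hy, rfl⟩
          exact (hf.invDistrib_mem (hIcc ▸ hy)).1
    _ = ∫ x in (0 : ℝ)..1, distrib f x ^ n := by rw [invDistrib_zero, h.1]

theorem isEndpoint (h : HasInverseSlope f p) (hf : IsSublebesgue f) :
    IsEndpoint (polyVal p.1) (distrib f 1) := by
  have hc : 0 ≤ distrib f 1 := hf.distrib_nonneg (by simp)
  have hneg : ∀ y ∈ Icc 0 (distrib f 1), polyVal p.1 y < 0 := fun y hy => (h.2 y hy).1
  have hpow := h.integral_pow hf 0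
  simp only [pow_zero, one_mul] at hpow
  rw [intervalIntegral.integral_add intervalIntegrable_const
    (intervalIntegrable_bose_comp hc (continuous_polyVal_right _).continuousOn hneg)] at hpow
  exact ⟨hc, hneg, by simpa using hpow⟩

end HasInverseSlope

/-- The density vector of a measure whose shape is the polynomial with coefficients `a` and whose
total mass is `c`. -/
def shapeDensities (a : Fin (k + 1) → ℝ) (c : ℝ) : Fin (k + 1) → ℝ := fun i =>
  ((i : ℕ) + 1) * ∫ y in (0 : ℝ)..c, y ^ (i : ℕ) * bose (polyVal a y)

theorem HasInverseSlope.densities_eq (h : HasInverseSlope f p) (hf : IsSublebesgue f) :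
    densities k f = shapeDensities p.1 (distrib f 1) := by
  ext i
  have hend := h.isEndpoint hf
  have hpow := h.integral_pow hf i
  simp only [mul_add, mul_one] at hpow
  rw [intervalIntegral.integral_add ((continuous_pow _).intervalIntegrable _ _)
    (intervalIntegrable_mul_bose_comp hend.nonneg (by fun_prop)
      (continuous_polyVal_right _).continuousOn hend.neg), _root_.integral_pow] at hpow
  rw [hf.densities_eq_sub, shapeDensities, ← hpow]
  field_simp
  simp

end Shape

section MomentInterior

variable {k : ℕ} {δ a : Fin (k + 1) → ℝ}

/-- The vectors with `0 < δ 0 < 1` whose moment functional is positive on the nonzero polynomials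
that are nonnegative on `[0, 1 - δ 0]`. This turns out to be the interior of the feasible region. -/
def momentInterior (k : ℕ) : Set (Fin (k + 1) → ℝ) :=
  {δ | 0 < δ 0 ∧ δ 0 < 1 ∧ ∀ a : Fin (k + 1) → ℝ, a ≠ 0 →
    (∀ y ∈ Icc 0 (1 - δ 0), 0 ≤ polyVal a y) → 0 < momentFun δ a}

theorem isClosed_nonneg_polyVal (k : ℕ) :
    IsClosed {q : (Fin (k + 1) → ℝ) × (Fin (k + 1) → ℝ) |
      q.1 0 ≤ 1 ∧ ∀ y ∈ Icc 0 (1 - q.1 0), 0 ≤ polyVal q.2 y} := by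
  have h := (isClosed_marginSet (k := k) (t := 0)).preimage
    (show Continuous fun q : (Fin (k + 1) → ℝ) × (Fin (k + 1) → ℝ) => (-q.2, 1 - q.1 0) by fun_prop)
  simpa only [marginSet, preimage_ofPred_eq, polyVal_neg, neg_zero, neg_nonpos, sub_nonneg] using h

theorem exists_coercive_of_isCompact {D : Set (Fin (k + 1) → ℝ)} (hD : IsCompact D)
    (hsub : D ⊆ momentInterior k) :
    ∃ ε > 0, ∀ δ ∈ D, ∀ a : Fin (k + 1) → ℝ, (∀ y ∈ Icc 0 (1 - δ 0), 0 ≤ polyVal a y) →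
      ε * ‖a‖ ≤ momentFun δ a := by
  have hS := (hD.prod (isCompact_sphere (0 : Fin (k + 1) → ℝ) 1)).inter_right
    (isClosed_nonneg_polyVal k)
  obtain ⟨ε, hε, hle⟩ := hS.exists_forall_le' continuous_momentFun.continuousOn (a := 0)
    fun q hq => (hsub hq.1.1).2.2 q.2 (ne_zero_of_mem_unit_sphere ⟨q.2, hq.1.2⟩) hq.2.2
  refine ⟨ε, hε, fun δ hδ a ha => ?_⟩
  rcases eq_or_ne a 0 with rfl | ha0
  · simp [momentFun]
  have hnorm : 0 < ‖a‖ := norm_pos_iff.2 ha0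
  have hunit : ε ≤ momentFun δ (‖a‖⁻¹ • a) := by
    refine hle (δ, ‖a‖⁻¹ • a) ⟨⟨hδ, ?_⟩, (hsub hδ).2.1.le, fun y hy => ?_⟩
    · simp [norm_smul, hnorm.ne']
    · rw [polyVal_smul]
      exact mul_nonneg (by positivity) (ha y hy)
  rwa [momentFun_smul, ← div_eq_inv_mul, le_div_iff₀ hnorm] at hunit

end MomentInterior

section DualFunctional

variable {k : ℕ} {δ a b : Fin (k + 1) → ℝ} {t t' c : ℝ}

/-- The Lagrange dual of entropy maximization under the constraint `densities k f = δ`. -/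
def dualFun (δ a : Fin (k + 1) → ℝ) : ℝ :=
  (∫ y in (0 : ℝ)..1 - δ 0, -Real.log (1 - Real.exp (polyVal a y))) - momentFun δ a

theorem neg_of_mem_marginSet (ht : 0 < t) (ha : (a, c) ∈ marginSet k t) :
    ∀ y ∈ Icc 0 c, polyVal a y < 0 :=
  fun y hy => (ha.2 y hy).trans_lt (neg_neg_of_pos ht)

theorem continuousOn_neg_log_one_sub_exp_polyVal {s : Set ℝ} (ha : ∀ y ∈ s, polyVal a y < 0) :
    ContinuousOn (fun y => -Real.log (1 - Real.exp (polyVal a y))) s :=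
  continuousOn_neg_log_one_sub_exp.comp (continuous_polyVal_right a).continuousOn ha

theorem continuousOn_dualFun (δ : Fin (k + 1) → ℝ) (ht : 0 < t) :
    ContinuousOn (dualFun δ) {a | (a, 1 - δ 0) ∈ marginSet k t} := by
  refine ContinuousOn.sub ?_
    (continuous_momentFun.comp (continuous_const.prodMk continuous_id)).continuousOn
  have h := (continuousOn_integral_mul_comp_polyVal (k := k) ht (φ := fun _ => 1) continuous_const
    continuousOn_neg_log_one_sub_exp).comp (s := {a | (a, 1 - δ 0) ∈ marginSet k t})
    (show Continuous fun a : Fin (k + 1) → ℝ => (a, 1 - δ 0) by fun_prop).continuousOn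
    fun a ha => ha
  exact h.congr fun a _ => by simp only [Function.comp_apply, one_mul]

theorem neg_momentFun_le_dualFun (hδ : δ 0 ≤ 1) (ha : ∀ y ∈ Icc 0 (1 - δ 0), polyVal a y < 0) :
    -momentFun δ a ≤ dualFun δ a := by
  have h : 0 ≤ ∫ y in (0 : ℝ)..1 - δ 0, -Real.log (1 - Real.exp (polyVal a y)) :=
    intervalIntegral.integral_nonneg (sub_nonneg.2 hδ) fun y hy => neg_nonneg.2 <|
      Real.log_nonpos (one_sub_exp_pos (ha y hy)).le (sub_le_self _ (Real.exp_pos _).le)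
  rw [dualFun]
  linarith

theorem exists_isMinOn_dualFun (hδ : δ ∈ momentInterior k) :
    ∃ R, ∀ t ∈ Ioc (0 : ℝ) 1, ∃ a, ‖a‖ ≤ R ∧ (a, 1 - δ 0) ∈ marginSet k t ∧
      IsMinOn (dualFun δ) {b | (b, 1 - δ 0) ∈ marginSet k t} a := by
  obtain ⟨ε, hε, hcoercive⟩ := exists_coercive_of_isCompact isCompact_singleton
    (singleton_subset_iff.2 hδ)
  let a₁ : Fin (k + 1) → ℝ := Pi.single 0 (-1)
  refine ⟨dualFun δ a₁ / ε, fun t ht => ?_⟩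
  have hδ1 : δ 0 ≤ 1 := hδ.2.1.le
  have ha₁ : (a₁, 1 - δ 0) ∈ marginSet k t :=
    ⟨sub_nonneg.2 hδ1, fun y _ => by simp [a₁, polyVal_single, ht.2]⟩
  have hbound {a : Fin (k + 1) → ℝ} (ha : (a, 1 - δ 0) ∈ marginSet k t) :
      ε * ‖a‖ ≤ dualFun δ a := by
    have hneg := neg_of_mem_marginSet ht.1 ha
    have h := hcoercive δ rfl (-a) fun y hy => by
      rw [polyVal_neg]
      exact (neg_pos.2 (hneg y hy)).le
    rw [norm_neg, momentFun_neg] at h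
    exact h.trans (neg_momentFun_le_dualFun hδ1 hneg)
  obtain ⟨a, ha, hmin⟩ := (continuousOn_dualFun δ ht.1).exists_isMinOn'
    (isClosed_marginSet.preimage (by fun_prop)) ha₁ <| by
    filter_upwards [mem_inf_of_left (isCompact_closedBall (0 : Fin (k + 1) → ℝ)
      (dualFun δ a₁ / ε)).compl_mem_cocompact, mem_inf_of_right (mem_principal_self _)] with a hR ha
    rw [mem_compl_iff, mem_closedBall_zero_iff, not_le, div_lt_iff₀' hε] at hR
    exact hR.le.trans (hbound ha)
  refine ⟨a, ?_, ha, hmin⟩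
  rw [le_div_iff₀' hε]
  exact (hbound ha).trans (hmin ha₁)

theorem dualFun_add_smul_le {s : ℝ} (hδ : δ 0 ≤ 1)
    (ha : ∀ y ∈ Icc 0 (1 - δ 0), polyVal a y < 0)
    (hab : ∀ y ∈ Icc 0 (1 - δ 0), polyVal (a + s • b) y < 0) :
    dualFun δ (a + s • b) ≤ dualFun δ a + s *
      ((∫ y in (0 : ℝ)..1 - δ 0, polyVal b y * bose (polyVal (a + s • b) y)) - momentFun δ b) := by
  have hc : 0 ≤ 1 - δ 0 := sub_nonneg.2 hδ
  have hlog {a : Fin (k + 1) → ℝ} (ha : ∀ y ∈ Icc 0 (1 - δ 0), polyVal a y < 0) :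
      IntervalIntegrable (fun y => -Real.log (1 - Real.exp (polyVal a y))) volume 0 (1 - δ 0) :=
    (continuousOn_neg_log_one_sub_exp_polyVal ha).intervalIntegrable_of_Icc hc
  have hbose : IntervalIntegrable (fun y => s * (polyVal b y * bose (polyVal (a + s • b) y)))
      volume 0 (1 - δ 0) :=
    (intervalIntegrable_mul_bose_comp hc (continuous_polyVal_right b).continuousOn
      (continuous_polyVal_right _).continuousOn hab).const_mul s
  have hmono := intervalIntegral.integral_mono_on hc (hlog hab) ((hlog ha).add hbose)
    fun y hy => by
      have htangent := neg_log_one_sub_exp_add_bose_mul_le (hab y hy) (ha y hy)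
      have hdiff : polyVal a y - polyVal (a + s • b) y = -(s * polyVal b y) := by
        rw [polyVal_add, polyVal_smul]
        ring
      rw [hdiff] at htangent
      linarith
  rw [intervalIntegral.integral_add (hlog ha) hbose, intervalIntegral.integral_const_mul] at hmono
  rw [dualFun, dualFun, momentFun_add, momentFun_smul]
  linarith

theorem momentFun_le_integral_of_isMinOn (hδ : δ 0 ≤ 1) (ht : 0 < t)
    (ha : (a, 1 - δ 0) ∈ marginSet k t)
    (hmin : IsMinOn (dualFun δ) {b | (b, 1 - δ 0) ∈ marginSet k t} a)
    (hb : ∀ᶠ s in 𝓝[>] (0 : ℝ), (a + s • b, 1 - δ 0) ∈ marginSet k t) :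
    momentFun δ b ≤ ∫ y in (0 : ℝ)..1 - δ 0, polyVal b y * bose (polyVal a y) := by
  have hpath : Tendsto (fun s : ℝ => (a + s • b, 1 - δ 0)) (𝓝[>] 0)
      (𝓝[marginSet k t] (a, 1 - δ 0)) := by
    refine tendsto_nhdsWithin_iff.2 ⟨?_, hb⟩
    have hcont : Continuous fun s : ℝ => (a + s • b, 1 - δ 0) := by fun_prop
    simpa using (hcont.tendsto 0).mono_left nhdsWithin_le_nhds
  refine ge_of_tendsto ((continuousOn_integral_mul_comp_polyVal ht (continuous_polyVal_right b)
    continuousOn_bose _ ha).tendsto.comp hpath) ?_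
  filter_upwards [hb, self_mem_nhdsWithin] with s hs hs0
  have hle := (hmin hs).trans
    (dualFun_add_smul_le hδ (neg_of_mem_marginSet ht ha) (neg_of_mem_marginSet ht hs))
  exact sub_nonneg.1 (nonneg_of_mul_nonneg_right (le_add_iff_nonneg_right _ |>.1 hle) hs0)

theorem eventually_add_smul_mem_marginSet (b : Fin (k + 1) → ℝ) (htt' : t < t') (hc : c ≤ 1)
    (ha : (a, c) ∈ marginSet k t') : ∀ᶠ s in 𝓝[>] (0 : ℝ), (a + s • b, c) ∈ marginSet k t := by
  have hsmall : ∀ᶠ s in 𝓝[>] (0 : ℝ), s * (((k : ℝ) + 1) * ‖b‖) < t' - t := by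
    have hcont : Continuous fun s : ℝ => s * (((k : ℝ) + 1) * ‖b‖) := by fun_prop
    exact nhdsWithin_le_nhds ((hcont.tendsto 0).eventually_lt_const (by simpa using htt'))
  filter_upwards [hsmall, self_mem_nhdsWithin] with s hs hs0
  refine ⟨ha.1, fun y hy => ?_⟩
  have hb : polyVal b y ≤ (k + 1) * ‖b‖ := (abs_le.1 (abs_polyVal_le b ⟨hy.1, hy.2.trans hc⟩)).2
  rw [polyVal_add, polyVal_smul]
  linarith [ha.2 y hy, mul_le_mul_of_nonneg_left hb (mem_Ioi.1 hs0).le]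

theorem shapeDensities_eq_of_forall_momentFun_le
    (h : ∀ b, momentFun δ b ≤ ∫ y in (0 : ℝ)..c, polyVal b y * bose (polyVal a y)) :
    shapeDensities a c = δ := by
  ext i
  have hpos := h (Pi.single i 1)
  have hneg := h (Pi.single i (-1))
  simp only [momentFun_single, polyVal_single, one_mul, neg_mul,
    intervalIntegral.integral_neg] at hpos hneg
  rw [shapeDensities, (neg_le_neg_iff.1 hneg).antisymm hpos]
  field_simp

theorem shapeDensities_zero (a : Fin (k + 1) → ℝ) (c : ℝ) :
    shapeDensities a c 0 = ∫ y in (0 : ℝ)..c, bose (polyVal a y) := by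
  simp [shapeDensities]

theorem exists_shapeDensities_eq (hδ : δ ∈ momentInterior k) :
    ∃ a, IsEndpoint (polyVal a) (1 - δ 0) ∧ shapeDensities a (1 - δ 0) = δ := by
  obtain ⟨R, hR⟩ := exists_isMinOn_dualFun hδ
  have hδ1 : δ 0 ≤ 1 := hδ.2.1.le
  have hc1 : 1 - δ 0 ≤ 1 := sub_le_self _ hδ.1.le
  obtain ⟨t', ht', hmargin⟩ := exists_margin_polyVal k R (δ 0) (sub_pos.2 hδ.2.1)
  let t : ℝ := min (t' / 2) 1
  have ht : 0 < t := lt_min (half_pos ht') one_pos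
  obtain ⟨a, haR, ha, hmin⟩ := hR t ⟨ht, min_le_right _ _⟩
  have hneg := neg_of_mem_marginSet ht ha
  have hmass : ∫ y in (0 : ℝ)..1 - δ 0, bose (polyVal a y) ≤ δ 0 := by
    have hconst := momentFun_le_integral_of_isMinOn hδ1 ht ha hmin (b := Pi.single 0 (-1)) <| by
      filter_upwards [self_mem_nhdsWithin] with s hs
      refine ⟨ha.1, fun y hy => ?_⟩
      rw [polyVal_add, polyVal_smul, polyVal_single, Fin.val_zero, pow_zero]
      linarith [ha.2 y hy, mem_Ioi.1 hs]
    simp only [momentFun_single, polyVal_single, Fin.val_zero, pow_zero, neg_mul, one_mul,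
      intervalIntegral.integral_neg, Nat.cast_zero, zero_add, div_one] at hconst
    exact neg_le_neg_iff.1 hconst
  have ha' : (a, 1 - δ 0) ∈ marginSet k t' :=
    ⟨ha.1, hmargin a haR _ ⟨le_rfl, hc1⟩ hneg hmass⟩
  have hmoments : shapeDensities a (1 - δ 0) = δ :=
    shapeDensities_eq_of_forall_momentFun_le fun b =>
      momentFun_le_integral_of_isMinOn hδ1 ht ha hmin <|
        eventually_add_smul_mem_marginSet b ((min_le_left _ _).trans_lt (half_lt_self ht')) hc1 ha'
  refine ⟨a, ⟨ha.1, hneg, ?_⟩, hmoments⟩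
  rw [← shapeDensities_zero, hmoments, sub_add_cancel]

end DualFunctional

section Gibbs

open InformationTheory

variable {q r u : ℝ}

theorem mul_klFun_div (hr : r ≠ 0) (q : ℝ) :
    r * klFun (q / r) = q * Real.log q - q * Real.log r + r - q := by
  rcases eq_or_ne q 0 with rfl | hq
  · simp [klFun_zero]
  · rw [klFun_apply, Real.log_div hq hr]
    field_simp

theorem linear_sub_binEntropy (q : ℝ) (hu : u < 0) :
    -(u * (1 - q)) + -Real.log (1 - Real.exp u) * q - Real.binEntropy q =
      (1 - Real.exp u) * klFun (q / (1 - Real.exp u)) +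
        Real.exp u * klFun ((1 - q) / Real.exp u) := by
  rw [mul_klFun_div (one_sub_exp_pos hu).ne', mul_klFun_div (Real.exp_pos u).ne', Real.log_exp,
    Real.binEntropy, Real.log_inv, Real.log_inv]
  ring

theorem binEntropy_le_linear (hq : q ∈ Icc (0 : ℝ) 1) (hu : u < 0) :
    Real.binEntropy q ≤ -(u * (1 - q)) + -Real.log (1 - Real.exp u) * q := by
  have hpos := one_sub_exp_pos hu
  rw [← sub_nonneg, linear_sub_binEntropy q hu]
  exact add_nonneg (mul_nonneg hpos.le (klFun_nonneg (div_nonneg hq.1 hpos.le)))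
    (mul_nonneg (Real.exp_pos u).le (klFun_nonneg (div_nonneg (sub_nonneg.2 hq.2)
      (Real.exp_pos u).le)))

theorem binEntropy_eq_linear_iff (hq : q ∈ Icc (0 : ℝ) 1) (hu : u < 0) :
    Real.binEntropy q = -(u * (1 - q)) + -Real.log (1 - Real.exp u) * q ↔
      q = 1 - Real.exp u := by
  have hpos := one_sub_exp_pos hu
  have hq₁ : 0 ≤ q / (1 - Real.exp u) := div_nonneg hq.1 hpos.le
  have hq₂ : 0 ≤ (1 - q) / Real.exp u := div_nonneg (sub_nonneg.2 hq.2) (Real.exp_pos u).le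
  rw [eq_comm, ← sub_eq_zero, linear_sub_binEntropy q hu, add_eq_zero_iff_of_nonneg
      (mul_nonneg hpos.le (klFun_nonneg hq₁)) (mul_nonneg (Real.exp_pos u).le (klFun_nonneg hq₂)),
    mul_eq_zero_iff_left hpos.ne', mul_eq_zero_iff_left (Real.exp_pos u).ne', klFun_eq_zero_iff hq₁,
    klFun_eq_zero_iff hq₂, div_eq_one_iff_eq hpos.ne', div_eq_one_iff_eq (Real.exp_pos u).ne',
    sub_eq_iff_eq_add, eq_sub_iff_add_eq]
  constructor
  · exact fun h => h.1
  · exact fun h => ⟨h, by linarith⟩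

end Gibbs

section Entropy

variable {k : ℕ} {f : ℝ → ℝ} {a : Fin (k + 1) → ℝ} {c : ℝ}

theorem IsSublebesgue.intervalIntegrable_binEntropy (hf : IsSublebesgue f) :
    IntervalIntegrable (fun x => Real.binEntropy (f x)) volume 0 1 := by
  rw [intervalIntegrable_iff_integrableOn_Ioc_of_le zero_le_one]
  refine Measure.integrableOn_of_bounded (M := Real.log 2) (by simp)
    (Real.binEntropy_continuous.measurable.comp hf.1).aestronglyMeasurable ?_
  filter_upwards [ae_restrict_mem measurableSet_Ioc] with x hx
  have h := hf.2 x ⟨hx.1.le, hx.2⟩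
  rw [Real.norm_eq_abs, abs_of_nonneg (Real.binEntropy_nonneg h.1 h.2)]
  exact Real.binEntropy_le_log_two

/-- The cross entropy density of `f` relative to the density of profile `polyVal a`; the integral of
the pointwise Gibbs bound for the entropy of `f` is the dual functional. -/
def crossEntropy (a : Fin (k + 1) → ℝ) (f : ℝ → ℝ) (x : ℝ) : ℝ :=
  -(polyVal a (distrib f x) * (1 - f x)) +
    -Real.log (1 - Real.exp (polyVal a (distrib f x))) * f x

theorem IsSublebesgue.intervalIntegrable_crossEntropy (hf : IsSublebesgue f)
    (hneg : ∀ y ∈ Icc 0 (distrib f 1), polyVal a y < 0) :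
    IntervalIntegrable (crossEntropy a f) volume 0 1 :=
  (hf.intervalIntegrable_comp_distrib_mul (continuous_polyVal_right a).continuousOn
    hf.one_sub).neg.add (hf.intervalIntegrable_comp_distrib_mul
      (continuousOn_neg_log_one_sub_exp_polyVal hneg) hf)

theorem IsSublebesgue.integral_crossEntropy (hf : IsSublebesgue f)
    (hneg : ∀ y ∈ Icc 0 (distrib f 1), polyVal a y < 0) :
    ∫ x in (0 : ℝ)..1, crossEntropy a f x = dualFun (densities k f) a := by
  have hlog := continuousOn_neg_log_one_sub_exp_polyVal hneg
  have hzeros : IntervalIntegrable (fun x => -(polyVal a (distrib f x) * (1 - f x))) volume 0 1 :=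
    (hf.intervalIntegrable_comp_distrib_mul (continuous_polyVal_right a).continuousOn
      hf.one_sub).neg
  have hsubst := hf.integral_comp_distrib_mul hlog (x := 1) (by simp)
  simp only [crossEntropy]
  rw [intervalIntegral.integral_add hzeros (hf.intervalIntegrable_comp_distrib_mul hlog hf),
    intervalIntegral.integral_neg, hf.integral_polyVal, hsubst, dualFun, ← hf.distrib_one,
    neg_add_eq_sub]

theorem IsSublebesgue.binEntropy_le_crossEntropy (hf : IsSublebesgue f)
    (hneg : ∀ y ∈ Icc 0 (distrib f 1), polyVal a y < 0) {x : ℝ} (hx : x ∈ Icc (0 : ℝ) 1) :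
    Real.binEntropy (f x) ≤ crossEntropy a f x :=
  binEntropy_le_linear (hf.2 x hx) (hneg _ (hf.distrib_mem hx))

theorem IsSublebesgue.entropy_le_dualFun (hf : IsSublebesgue f)
    (hneg : ∀ y ∈ Icc 0 (distrib f 1), polyVal a y < 0) :
    entropy f ≤ dualFun (densities k f) a := by
  rw [← hf.integral_crossEntropy hneg]
  exact intervalIntegral.integral_mono_on zero_le_one hf.intervalIntegrable_binEntropy
    (hf.intervalIntegrable_crossEntropy hneg) fun x hx => hf.binEntropy_le_crossEntropy hneg hx

theorem IsSublebesgue.entropy_eq_dualFun_iff (hf : IsSublebesgue f)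
    (hneg : ∀ y ∈ Icc 0 (distrib f 1), polyVal a y < 0) :
    entropy f = dualFun (densities k f) a ↔ IsProfileDensity (polyVal a) f := by
  have hint := hf.intervalIntegrable_crossEntropy hneg
  have hgap : 0 ≤ᵐ[volume.restrict (Ioc 0 1)] fun x => crossEntropy a f x - Real.binEntropy (f x) :=
    (ae_restrict_mem measurableSet_Ioc).mono fun x hx =>
      sub_nonneg.2 (hf.binEntropy_le_crossEntropy hneg (Ioc_subset_Icc_self hx))
  rw [← hf.integral_crossEntropy hneg, entropy, eq_comm, ← sub_eq_zero,
    ← intervalIntegral.integral_sub hint hf.intervalIntegrable_binEntropy,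
    intervalIntegral.integral_eq_zero_iff_of_le_of_nonneg_ae zero_le_one hgap
      (hint.sub hf.intervalIntegrable_binEntropy),
    IsProfileDensity, SameMeasure, ← Measure.restrict_congr_set Ioc_ae_eq_Icc]
  refine eventually_congr ?_
  filter_upwards [ae_restrict_mem measurableSet_Ioc] with x hx
  have hx := Ioc_subset_Icc_self hx
  rw [Pi.zero_apply, sub_eq_zero, eq_comm]
  exact binEntropy_eq_linear_iff (hf.2 x hx) (hneg _ (hf.distrib_mem hx))

theorem IsEndpoint.shapeDensities_zero (h : IsEndpoint (polyVal a) c) :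
    shapeDensities a c 0 = 1 - c := by
  rw [PatternDensity.shapeDensities_zero, h.integral_bose]

theorem IsEndpoint.coeff_zero_neg (h : IsEndpoint (polyVal a) c) : a 0 < 0 := by
  rw [← polyVal_zero_right a]
  exact h.neg 0 ⟨le_rfl, h.nonneg⟩

theorem IsEndpoint.exists_isLimitShape {p : NegPoly k} (h : IsEndpoint (polyVal p.1) c) :
    ∃ f, IsLimitShape k (shapeDensities p.1 c) f ∧ ∀ g,
      IsLimitShape k (shapeDensities p.1 c) g → SameMeasure f g ∧ HasInverseSlope g p := by
  obtain ⟨f, hf, hfc, hfp⟩ := h.exists_isProfileDensity (continuous_polyVal_right p.1)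
  have hfd : densities k f = shapeDensities p.1 c := by
    rw [(h.hasInverseSlope hf hfc hfp).densities_eq hf, hfc]
  have hmass {g : ℝ → ℝ} (hg : IsSublebesgue g) (hgd : densities k g = shapeDensities p.1 c) :
      distrib g 1 = c := by
    rw [hg.distrib_one k, hgd, h.shapeDensities_zero, sub_sub_cancel]
  have hent : entropy f = dualFun (shapeDensities p.1 c) p.1 := by
    rw [← hfd]
    exact (hf.entropy_eq_dualFun_iff (hfc.symm ▸ h.neg)).2 hfp
  have hfmax : IsLimitShape k (shapeDensities p.1 c) f := by
    refine ⟨hf, hfd, fun g hg hgd => ?_⟩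
    rw [hent, ← hgd]
    exact hg.entropy_le_dualFun ((hmass hg hgd).symm ▸ h.neg)
  refine ⟨f, hfmax, fun g ⟨hg, hgd, hgmax⟩ => ?_⟩
  have hgc := hmass hg hgd
  have hgp : IsProfileDensity (polyVal p.1) g := by
    refine (hg.entropy_eq_dualFun_iff (hgc.symm ▸ h.neg)).1 ?_
    rw [hgd, ← hent]
    exact (hfmax.2.2 g hg hgd).antisymm (hgmax f hf hfd)
  exact ⟨h.sameMeasure_of_isProfileDensity (continuous_polyVal_right p.1) hf hg hfc hgc hfp hgp,
    h.hasInverseSlope hg hgc hgp⟩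

theorem limitShape_of_mem_momentInterior {δ : Fin (k + 1) → ℝ} (hδ : δ ∈ momentInterior k) :
    (∃ f, IsLimitShape k δ f) ∧
      (∀ f g, IsLimitShape k δ f → IsLimitShape k δ g → SameMeasure f g) ∧
      (∀ f, IsLimitShape k δ f → ∃ p : NegPoly k, HasInverseSlope f p) := by
  obtain ⟨a, ha, hshape⟩ := exists_shapeDensities_eq hδ
  obtain ⟨f, hf, hunique⟩ := IsEndpoint.exists_isLimitShape (p := ⟨a, ha.coeff_zero_neg⟩) ha
  rw [hshape] at hf hunique
  exact ⟨⟨f, hf⟩, fun g g' hg hg' => (hunique g hg).1.symm.trans (hunique g' hg').1,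
    fun g hg => ⟨_, (hunique g hg).2⟩⟩

end Entropy

section Interior

variable {k : ℕ} {δ a : Fin (k + 1) → ℝ} {c : ℝ}

theorem polyVal_eq_eval_ofFn (a : Fin (k + 1) → ℝ) (y : ℝ) :
    polyVal a y = (Polynomial.ofFn (k + 1) a).eval y := by
  simp [polyVal, dotProduct, Polynomial.ofFn_eq_sum_monomial, Polynomial.eval_finsetSum]

theorem ofFn_ne_zero (ha : a ≠ 0) : Polynomial.ofFn (k + 1) a ≠ 0 :=
  (map_ne_zero_iff _ (Polynomial.injective_ofFn _)).2 ha

theorem eq_zero_of_forall_polyVal_eq_zero (hc : 0 < c) (h : ∀ y ∈ Icc 0 c, polyVal a y = 0) :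
    a = 0 := by
  by_contra ha
  refine ofFn_ne_zero ha (Polynomial.eq_zero_of_infinite_isRoot _ ?_)
  refine (Icc_infinite hc).mono fun y hy => ?_
  rw [mem_ofPred_eq, Polynomial.IsRoot.def, ← polyVal_eq_eval_ofFn, h y hy]

theorem momentFun_nonneg (hδ : δ ∈ feasible k) (ha : ∀ y ∈ Icc 0 (1 - δ 0), 0 ≤ polyVal a y) :
    0 ≤ momentFun δ a := by
  obtain ⟨f, hf, rfl⟩ := mem_feasible.1 hδ
  rw [← hf.integral_polyVal]
  rw [← hf.distrib_one] at ha
  exact intervalIntegral.integral_nonneg zero_le_one fun x hx =>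
    mul_nonneg (ha _ (hf.distrib_mem hx)) (hf.one_sub.2 x hx).1

theorem apply_mem_Ioo_of_mem_interior_feasible (hδ : δ ∈ interior (feasible k))
    (i : Fin (k + 1)) : δ i ∈ Ioo (0 : ℝ) 1 := by
  have hsub : feasible k ⊆ Function.eval i ⁻¹' Icc 0 1 := fun δ hδ => hδ.1 i
  have h := interior_mono hsub hδ
  rwa [← (isOpenMap_eval i).preimage_interior_eq_interior_preimage (continuous_apply i),
    interior_Icc] at h

theorem momentFun_add_smul_single (δ a : Fin (k + 1) → ℝ) (s x : ℝ) (i : Fin (k + 1)) :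
    momentFun (δ + s • Pi.single i x) a = momentFun δ a + s * (x / (i + 1) * a i) := by
  have hdiv : (fun j : Fin (k + 1) => (δ + s • Pi.single i x : Fin (k + 1) → ℝ) j / ((j : ℝ) + 1)) =
      (fun j : Fin (k + 1) => δ j / ((j : ℝ) + 1)) + Pi.single i (s * x / ((i : ℝ) + 1)) := by
    ext j
    rcases eq_or_ne j i with rfl | hj
    · simp [add_div]
    · simp [hj]
  rw [momentFun, hdiv, dotProduct_add, dotProduct_single, momentFun]
  ring

/-- Perturbing `δ` along the coordinate `i ≠ 0` against the sign of `a i` decreases the moment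
functional but leaves the interval `[0, 1 - δ 0]` unchanged. -/
theorem momentFun_pos_of_apply_ne_zero (hδ : δ ∈ interior (feasible k))
    (ha : ∀ y ∈ Icc 0 (1 - δ 0), 0 ≤ polyVal a y) {i : Fin (k + 1)} (hi : i ≠ 0)
    (hai : a i ≠ 0) : 0 < momentFun δ a := by
  have hpath : Continuous fun s : ℝ => δ + s • Pi.single i (-a i) := by fun_prop
  have hfeas : ∀ᶠ s in 𝓝[>] (0 : ℝ), δ + s • Pi.single i (-a i) ∈ feasible k :=
    nhdsWithin_le_nhds <| hpath.continuousAt.eventually <| by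
      simpa using mem_interior_iff_mem_nhds.1 hδ
  obtain ⟨s, hs, hs0⟩ := (hfeas.and self_mem_nhdsWithin).exists
  have hnonneg := momentFun_nonneg hs (a := a) (by simpa [hi.symm] using ha)
  have hpos : 0 < s * (a i / (i + 1) * a i) := mul_pos hs0 <| by
    rw [div_mul_eq_mul_div]
    exact div_pos (mul_self_pos.2 hai) (by positivity)
  rw [momentFun_add_smul_single, neg_div, neg_mul, mul_neg] at hnonneg
  linarith

theorem interior_feasible_subset (k : ℕ) : interior (feasible k) ⊆ momentInterior k := by
  intro δ hδ
  obtain ⟨hδ0, hδ1⟩ := apply_mem_Ioo_of_mem_interior_feasible hδ 0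
  refine ⟨hδ0, hδ1, fun a ha hpos => ?_⟩
  by_cases! hconst : ∃ i ≠ 0, a i ≠ 0
  · obtain ⟨i, hi, hai⟩ := hconst
    exact momentFun_pos_of_apply_ne_zero hδ hpos hi hai
  · have hsingle : a = Pi.single 0 (a 0) := by
      ext i
      rcases eq_or_ne i 0 with rfl | hi
      · simp
      · simp [hi, hconst i hi]
    have ha0 : a 0 ≠ 0 := fun h => ha (by rw [hsingle, h, Pi.single_zero])
    have ha0_nonneg : 0 ≤ a 0 := by
      simpa only [polyVal_zero_right] using hpos 0 ⟨le_rfl, (sub_pos.2 hδ1).le⟩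
    rw [hsingle, momentFun_single]
    exact mul_pos (ha0_nonneg.lt_of_ne' ha0) (by simpa using hδ0)

theorem mem_momentInterior_iff : δ ∈ momentInterior k ↔ 0 < δ 0 ∧ δ 0 < 1 ∧
    ∀ a ∈ Metric.sphere (0 : Fin (k + 1) → ℝ) 1,
      (∀ y ∈ Icc 0 (1 - δ 0), 0 ≤ polyVal a y) → 0 < momentFun δ a := by
  refine and_congr_right fun _ => and_congr_right fun _ =>
    ⟨fun h a ha => h a (ne_zero_of_mem_unit_sphere ⟨a, ha⟩), fun h a ha hpos => ?_⟩
  have hnorm : 0 < ‖a‖⁻¹ := inv_pos.2 (norm_pos_iff.2 ha)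
  have hunit := h (‖a‖⁻¹ • a) (by simp [norm_smul, ha]) fun y hy => by
    rw [polyVal_smul]
    exact mul_nonneg hnorm.le (hpos y hy)
  rw [momentFun_smul] at hunit
  exact pos_of_mul_pos_right hunit hnorm.le

theorem isOpen_momentInterior (k : ℕ) : IsOpen (momentInterior k) := by
  rw [isOpen_iff_eventually]
  intro δ hδ
  have hopen : IsOpen {q : (Fin (k + 1) → ℝ) × (Fin (k + 1) → ℝ) |
      (q.1 0 ≤ 1 ∧ ∀ y ∈ Icc 0 (1 - q.1 0), 0 ≤ polyVal q.2 y) → 0 < momentFun q.1 q.2} := by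
    refine isOpen_iff_mem_nhds.2 fun q hq => ?_
    by_cases hmem : q.1 0 ≤ 1 ∧ ∀ y ∈ Icc 0 (1 - q.1 0), 0 ≤ polyVal q.2 y
    · filter_upwards [continuous_momentFun.continuousAt.eventually_const_lt (hq hmem)]
        with r hr _ using hr
    · filter_upwards [(isClosed_nonneg_polyVal k).isOpen_compl.mem_nhds hmem]
        with r hr h using absurd h hr
  have hsphere := (isCompact_sphere (0 : Fin (k + 1) → ℝ) 1).eventually_forall_of_forall_eventually
    (x₀ := δ) (P := fun d a => (d 0 ≤ 1 ∧ ∀ y ∈ Icc 0 (1 - d 0), 0 ≤ polyVal a y) →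
      0 < momentFun d a) fun a ha => hopen.mem_nhds (x := (δ, a)) fun h =>
      hδ.2.2 a (ne_zero_of_mem_unit_sphere ⟨a, ha⟩) h.2
  have hcoord : ContinuousAt (fun d : Fin (k + 1) → ℝ => d 0) δ := (continuous_apply 0).continuousAt
  filter_upwards [hsphere, hcoord.eventually_const_lt hδ.1, hcoord.eventually_lt_const hδ.2.1]
    with d hd h0 h1
  exact mem_momentInterior_iff.2 ⟨h0, h1, fun a ha hpos => hd a ha ⟨h1.le, hpos⟩⟩

theorem interior_feasible (k : ℕ) : interior (feasible k) = momentInterior k := by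
  refine (interior_feasible_subset k).antisymm (interior_maximal ?_ (isOpen_momentInterior k))
  intro δ hδ
  obtain ⟨f, hf⟩ := (limitShape_of_mem_momentInterior hδ).1
  exact mem_feasible.2 ⟨f, hf.1, hf.2.1⟩

end Interior

section Parametrization

variable {k : ℕ} {a b : Fin (k + 1) → ℝ} {c c' : ℝ}

theorem momentFun_shapeDensities (h : IsEndpoint (polyVal a) c) (b : Fin (k + 1) → ℝ) :
    momentFun (shapeDensities a c) b = ∫ y in (0 : ℝ)..c, polyVal b y * bose (polyVal a y) := by
  refine Eq.trans ?_ (integral_polyVal_comp_mul b (φ := fun y => y) fun i =>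
    intervalIntegrable_mul_bose_comp h.nonneg (continuous_pow _).continuousOn
      (continuous_polyVal_right a).continuousOn h.neg).symm
  rw [momentFun]
  congr 1 with i
  rw [shapeDensities, mul_div_cancel_left₀ _ (by positivity)]

theorem IsEndpoint.shapeDensities_mem (h : IsEndpoint (polyVal a) c) :
    shapeDensities a c ∈ momentInterior k := by
  have hzero := h.shapeDensities_zero
  refine ⟨?_, ?_, fun b hb hpos => ?_⟩
  · rw [hzero]
    exact sub_pos.2 (h.lt_one (continuous_polyVal_right a))
  · rw [hzero]
    exact sub_lt_self _ h.pos
  · rw [hzero, sub_sub_cancel] at hpos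
    rw [momentFun_shapeDensities h]
    refine intervalIntegral.integral_pos h.pos ?_ (fun y hy => ?_) ?_
    · exact (continuous_polyVal_right b).continuousOn.mul
        (continuousOn_bose.comp (continuous_polyVal_right a).continuousOn h.neg)
    · exact mul_nonneg (hpos y (Ioc_subset_Icc_self hy)) (bose_pos (h.neg y
        (Ioc_subset_Icc_self hy))).le
    · by_contra! hle
      refine hb (eq_zero_of_forall_polyVal_eq_zero h.pos fun y hy => (hpos y hy).antisymm' ?_)
      exact nonpos_of_mul_nonpos_left (hle y hy) (bose_pos (h.neg y hy))

/-- The pairs `(a, c)` for which the profile of the polynomial with coefficients `a` reaches `1`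
at `c`: the graph of the map `endpoint`. -/
def endpointSet (k : ℕ) : Set ((Fin (k + 1) → ℝ) × ℝ) := {q | IsEndpoint (polyVal q.1) q.2}

theorem exists_marginSet_mem_nhdsWithin_endpointSet {q₀ : (Fin (k + 1) → ℝ) × ℝ}
    (h : 0 < q₀.2 ∨ q₀.1 0 < 0) : ∃ t > 0, marginSet k t ∈ 𝓝[endpointSet k] q₀ := by
  rcases lt_or_ge 0 q₀.2 with hpos | hnonpos
  · obtain ⟨t, ht, hmargin⟩ := exists_margin_polyVal k (‖q₀.1‖ + 1) 1 (half_pos hpos)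
    refine ⟨t, ht, ?_⟩
    have hnorm : ∀ᶠ q in 𝓝[endpointSet k] q₀, ‖q.1‖ < ‖q₀.1‖ + 1 :=
      nhdsWithin_le_nhds <| (by fun_prop : ContinuousAt (fun q => ‖q.1‖)
        q₀).eventually_lt_const (lt_add_one _)
    have hhalf : ∀ᶠ q in 𝓝[endpointSet k] q₀, q₀.2 / 2 < q.2 :=
      nhdsWithin_le_nhds <| continuousAt_snd.eventually_const_lt (half_lt_self hpos)
    filter_upwards [self_mem_nhdsWithin, hnorm, hhalf] with q (hq : IsEndpoint _ _) hqa hqc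
    refine ⟨hq.nonneg, hmargin _ hqa.le _
      ⟨hqc.le, (hq.lt_one (continuous_polyVal_right _)).le⟩ hq.neg ?_⟩
    rw [hq.integral_bose]
    exact sub_le_self _ hq.nonneg
  · have hneg : q₀.1 0 < 0 := h.resolve_left hnonpos.not_gt
    refine ⟨-(q₀.1 0 / 2), by linarith, ?_⟩
    have hnear : ∀ᶠ r in 𝓝 (q₀.1, (0 : ℝ)), polyVal r.1 r.2 < q₀.1 0 / 2 := by
      refine continuous_polyVal.continuousAt.eventually_lt_const ?_
      simp only [polyVal_zero_right]
      linarith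
    obtain ⟨U, hU, V, hV, hUV⟩ := mem_nhds_prod_iff.1 hnear
    obtain ⟨η, hη, hηV⟩ := Metric.mem_nhds_iff.1 hV
    have hsmall : ∀ᶠ q in 𝓝[endpointSet k] q₀, q.2 < η :=
      nhdsWithin_le_nhds <| continuousAt_snd.eventually_lt_const (hnonpos.trans_lt hη)
    filter_upwards [self_mem_nhdsWithin, hsmall, nhdsWithin_le_nhds (continuousAt_fst hU)]
      with q (hq : IsEndpoint _ _) hqη hqU
    refine ⟨hq.nonneg, fun y hy => ?_⟩
    rw [neg_neg]
    have hyV : y ∈ V := hηV <| by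
      rw [mem_ball_zero_iff, Real.norm_of_nonneg hy.1]
      exact hy.2.trans_lt hqη
    have hval : polyVal q.1 y < q₀.1 0 / 2 := hUV (mk_mem_prod hqU hyV)
    exact hval.le

theorem isEndpoint_of_mem_closure {q : (Fin (k + 1) → ℝ) × ℝ} (hq : q ∈ closure (endpointSet k))
    (h : 0 < q.2 ∨ q.1 0 < 0) : IsEndpoint (polyVal q.1) q.2 := by
  obtain ⟨t, ht, hmem⟩ := exists_marginSet_mem_nhdsWithin_endpointSet h
  have : (𝓝[endpointSet k] q).NeBot := mem_closure_iff_nhdsWithin_neBot.1 hq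
  have hqt : q ∈ marginSet k t := isClosed_marginSet.mem_of_frequently_of_tendsto
    (Eventually.frequently hmem) (tendsto_id'.2 nhdsWithin_le_nhds)
  refine ⟨hqt.1, neg_of_mem_marginSet ht hqt, ?_⟩
  have hcont : ContinuousWithinAt (fun q : (Fin (k + 1) → ℝ) × ℝ =>
      q.2 + ∫ y in (0 : ℝ)..q.2, 1 * bose (polyVal q.1 y)) (endpointSet k) q :=
    (continuousWithinAt_snd.add (continuousOn_integral_mul_comp_polyVal ht continuous_const
      continuousOn_bose q hqt)).mono_of_mem_nhdsWithin hmem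
  simp only [one_mul] at hcont
  refine tendsto_nhds_unique hcont (tendsto_const_nhds.congr' ?_)
  filter_upwards [self_mem_nhdsWithin] with r (hr : IsEndpoint _ _) using hr.integral_eq.symm

theorem continuousOn_shapeDensities :
    ContinuousOn (fun q : (Fin (k + 1) → ℝ) × ℝ => shapeDensities q.1 q.2) (endpointSet k) := by
  intro q (hq : IsEndpoint _ _)
  obtain ⟨t, ht, hmem⟩ := exists_marginSet_mem_nhdsWithin_endpointSet (.inl hq.pos)
  have hqt : q ∈ marginSet k t := mem_of_mem_nhdsWithin hq hmem
  refine continuousWithinAt_pi.2 fun i => ContinuousWithinAt.mono_of_mem_nhdsWithin ?_ hmem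
  exact continuousWithinAt_const.mul
    (continuousOn_integral_mul_comp_polyVal ht (continuous_pow _) continuousOn_bose q hqt)

theorem NegPoly.exists_isEndpoint (p : NegPoly k) : ∃ c, IsEndpoint (polyVal p.1) c :=
  PatternDensity.exists_isEndpoint (continuous_polyVal_right p.1) (lipschitzOnWith_polyVal p.1)
    ((polyVal_zero_right p.1).trans_lt p.2)

/-- The value `F(1)` of the distribution function `F` of shape `p`. -/
def endpoint (p : NegPoly k) : ℝ := p.exists_isEndpoint.choose

theorem isEndpoint_endpoint (p : NegPoly k) : IsEndpoint (polyVal p.1) (endpoint p) :=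
  p.exists_isEndpoint.choose_spec

theorem IsEndpoint.endpoint_eq {p : NegPoly k} (h : IsEndpoint (polyVal p.1) c) :
    endpoint p = c :=
  (isEndpoint_endpoint p).unique h (continuous_polyVal_right p.1)

theorem continuous_endpoint : Continuous (endpoint (k := k)) := by
  refine continuous_iff_continuousAt.2 fun p => ?_
  refine isCompact_Icc.tendsto_nhds_of_unique_mapClusterPt (s := Icc (0 : ℝ) 1)
    (Eventually.of_forall fun q => ⟨(isEndpoint_endpoint q).nonneg,
      ((isEndpoint_endpoint q).lt_one (continuous_polyVal_right _)).le⟩) fun c _ hc => ?_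
  obtain ⟨U, hU, hUc⟩ := mapClusterPt_iff_ultrafilter.1 hc
  have hclosure : (p.1, c) ∈ closure (endpointSet k) :=
    mem_closure_of_tendsto (((continuous_subtype_val.tendsto p).mono_left hU).prodMk_nhds hUc)
      (Eventually.of_forall isEndpoint_endpoint)
  exact (isEndpoint_of_mem_closure hclosure (.inr p.2)).endpoint_eq.symm

/-- The density vector of the measures of shape `p`. -/
def densityMap (p : NegPoly k) : momentInterior k :=
  ⟨shapeDensities p.1 (endpoint p), (isEndpoint_endpoint p).shapeDensities_mem⟩

theorem IsEndpoint.coe_densityMap {p : NegPoly k} (h : IsEndpoint (polyVal p.1) c) :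
    (densityMap p : Fin (k + 1) → ℝ) = shapeDensities p.1 c :=
  congrArg (shapeDensities p.1) h.endpoint_eq

theorem continuous_densityMap : Continuous (densityMap (k := k)) :=
  (continuousOn_shapeDensities.comp_continuous (continuous_subtype_val.prodMk continuous_endpoint)
    isEndpoint_endpoint).subtype_mk _

theorem HasInverseSlope.eq {f : ℝ → ℝ} {p q : NegPoly k} (hf : IsSublebesgue f)
    (hp : HasInverseSlope f p) (hq : HasInverseSlope f q) : p = q := by
  have hc := (hp.isEndpoint hf).pos
  refine Subtype.ext (sub_eq_zero.1 (eq_zero_of_forall_polyVal_eq_zero hc fun y hy => ?_))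
  have hslope := (uniqueDiffOn_Icc hc y hy).eq_deriv _ (hp.2 y hy).2 (hq.2 y hy).2
  rw [one_div, one_div, inv_inj, sub_right_inj, Real.exp_eq_exp] at hslope
  rw [sub_eq_add_neg, polyVal_add, polyVal_neg, add_neg_eq_zero]
  exact hslope

/-- The entropy maximizer with given densities is unique, and determines its shape. -/
theorem injective_densityMap : Function.Injective (densityMap (k := k)) := by
  intro p q hpq
  obtain ⟨f, hf, hfp⟩ := (isEndpoint_endpoint p).exists_isLimitShape
  obtain ⟨g, -, hgq⟩ := (isEndpoint_endpoint q).exists_isLimitShape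
  have heq : shapeDensities p.1 (endpoint p) = shapeDensities q.1 (endpoint q) :=
    congrArg Subtype.val hpq
  exact HasInverseSlope.eq hf.1 (hfp f hf).2 (hgq f (heq ▸ hf)).2

theorem surjective_densityMap : Function.Surjective (densityMap (k := k)) := by
  rintro ⟨δ, hδ⟩
  obtain ⟨a, ha, hshape⟩ := exists_shapeDensities_eq hδ
  refine ⟨⟨a, ha.coeff_zero_neg⟩, Subtype.ext ?_⟩
  exact (IsEndpoint.coe_densityMap (p := ⟨a, _⟩) ha).trans hshape

theorem exists_norm_le_of_isCompact {D : Set (Fin (k + 1) → ℝ)} (hD : IsCompact D)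
    (hsub : D ⊆ momentInterior k) :
    ∃ R, ∀ (a : Fin (k + 1) → ℝ) (c : ℝ), IsEndpoint (polyVal a) c → shapeDensities a c ∈ D →
      ‖a‖ ≤ R := by
  obtain ⟨ε, hε, hcoercive⟩ := exists_coercive_of_isCompact hD hsub
  refine ⟨1 / ε, fun a c h hmem => (le_div_iff₀' hε).2 ?_⟩
  have hnonneg : ∀ y ∈ Icc 0 c, 0 ≤ polyVal (-a) y := fun y hy => by
    rw [polyVal_neg]
    exact (neg_pos.2 (h.neg y hy)).le
  calc ε * ‖a‖ = ε * ‖-a‖ := by rw [norm_neg]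
    _ ≤ momentFun (shapeDensities a c) (-a) :=
        hcoercive _ hmem (-a) (by rwa [h.shapeDensities_zero, sub_sub_cancel])
    _ = ∫ y in (0 : ℝ)..c, polyVal (-a) y * bose (polyVal a y) := momentFun_shapeDensities h _
    _ ≤ ∫ _ in (0 : ℝ)..c, (1 : ℝ) :=
        intervalIntegral.integral_mono_on h.nonneg
          (intervalIntegrable_mul_bose_comp h.nonneg (continuous_polyVal_right _).continuousOn
            (continuous_polyVal_right _).continuousOn h.neg)
          intervalIntegrable_const fun y hy => by
            rw [polyVal_neg]
            exact neg_mul_bose_le (h.neg y hy)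
    _ ≤ 1 := by simpa using (h.lt_one (continuous_polyVal_right a)).le

theorem isProperMap_densityMap : IsProperMap (densityMap (k := k)) := by
  refine isProperMap_iff_ultrafilter_of_t2.2 ⟨continuous_densityMap, fun U δ hδ => ?_⟩
  have hval : Tendsto (fun p : NegPoly k => (densityMap p : Fin (k + 1) → ℝ)) U (𝓝 δ) :=
    (continuous_subtype_val.tendsto δ).comp hδ
  have hnhds : momentInterior k ∈ 𝓝 (δ : Fin (k + 1) → ℝ) :=
    (isOpen_momentInterior k).mem_nhds δ.2
  obtain ⟨D, hDmem, hDsub, hD⟩ := local_compact_nhds hnhds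
  obtain ⟨R, hR⟩ := exists_norm_le_of_isCompact hD hDsub
  have hball : ∀ᶠ p in (U : Filter (NegPoly k)), p.1 ∈ Metric.closedBall 0 R := by
    filter_upwards [hval hDmem] with p hp
    exact mem_closedBall_zero_iff.2 (hR _ _ (isEndpoint_endpoint p) hp)
  obtain ⟨a, -, ha⟩ := (isCompact_closedBall (0 : Fin (k + 1) → ℝ) R).ultrafilter_le_nhds'
    (U.map Subtype.val) hball
  have ha : Tendsto (fun p : NegPoly k => p.1) U (𝓝 a) := ha
  have hendpoint : Tendsto (endpoint (k := k)) U (𝓝 (1 - δ.1 0)) := by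
    refine ((((continuous_apply 0).tendsto δ.1).comp hval).const_sub 1).congr fun p => ?_
    simp only [Function.comp_apply, densityMap, (isEndpoint_endpoint p).shapeDensities_zero,
      sub_sub_cancel]
  have hclosure : (a, 1 - δ.1 0) ∈ closure (endpointSet k) :=
    mem_closure_of_tendsto (ha.prodMk_nhds hendpoint) (Eventually.of_forall isEndpoint_endpoint)
  have h := isEndpoint_of_mem_closure hclosure (.inl (sub_pos.2 δ.2.2.1))
  exact ⟨⟨a, h.coeff_zero_neg⟩, tendsto_subtype_rng.2 ha⟩

/-- The homeomorphism from shapes to density vectors. -/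
def densityHomeomorph (k : ℕ) : NegPoly k ≃ₜ momentInterior k :=
  (Equiv.ofBijective densityMap
    ⟨injective_densityMap, surjective_densityMap⟩).toHomeomorphOfContinuousClosed
    continuous_densityMap isProperMap_densityMap.isClosedMap

theorem exists_homeomorph (k : ℕ) :
    ∃ Φ : NegPoly k ≃ₜ interior (feasible k), ∀ p : NegPoly k,
      (∃ f, IsSublebesgue f ∧ HasInverseSlope f p) ∧
      (∀ f, IsSublebesgue f → HasInverseSlope f p → densities k f = (Φ p : Fin (k + 1) → ℝ)) := by
  rw [interior_feasible]
  refine ⟨densityHomeomorph k, fun p => ⟨?_, fun f hf hfp => ?_⟩⟩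
  · obtain ⟨f, hf, hfp⟩ := (isEndpoint_endpoint p).exists_isLimitShape
    exact ⟨f, hf.1, (hfp f hf).2⟩
  · rw [hfp.densities_eq hf]
    exact (hfp.isEndpoint hf).coe_densityMap.symm

end Parametrization

section Boundary

variable {k : ℕ} {f g : ℝ → ℝ} {δ a : Fin (k + 1) → ℝ} {Z : Finset ℝ} {x y : ℝ}

theorem exists_null_polyVal (hδ : δ ∈ feasible k) (hδ' : δ ∉ momentInterior k) (h1 : δ 0 < 1) :
    ∃ a : Fin (k + 1) → ℝ, a ≠ 0 ∧ (∀ y ∈ Icc 0 (1 - δ 0), 0 ≤ polyVal a y) ∧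
      momentFun δ a = 0 := by
  rcases (hδ.1 0).1.eq_or_lt with h0 | h0
  · refine ⟨Pi.single 0 1, by simp, fun y _ => by simp [polyVal_single], ?_⟩
    rw [momentFun_single, ← h0]
    simp
  · simp only [momentInterior, mem_ofPred_eq, h0, h1, true_and] at hδ'
    push Not at hδ'
    obtain ⟨a, ha, hpos, hle⟩ := hδ'
    exact ⟨a, ha, hpos, hle.antisymm (momentFun_nonneg hδ hpos)⟩

/-- The set of roots of the polynomial with coefficients `a` (empty for `a = 0`). -/
def polyZeros (a : Fin (k + 1) → ℝ) : Finset ℝ := (Polynomial.ofFn (k + 1) a).roots.toFinset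

theorem mem_polyZeros (ha : a ≠ 0) : y ∈ polyZeros a ↔ polyVal a y = 0 := by
  rw [polyZeros, Multiset.mem_toFinset, Polynomial.mem_roots (ofFn_ne_zero ha),
    Polynomial.IsRoot.def, polyVal_eq_eval_ofFn]

theorem card_polyZeros_le (a : Fin (k + 1) → ℝ) : (polyZeros a).card ≤ k :=
  calc (polyZeros a).card ≤ Multiset.card (Polynomial.ofFn (k + 1) a).roots :=
        Multiset.toFinset_card_le _
    _ ≤ (Polynomial.ofFn (k + 1) a).natDegree := Polynomial.card_roots' _
    _ ≤ k := Nat.lt_succ_iff.1 (Polynomial.ofFn_natDegree_lt k.succ_pos a)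

theorem exists_polyVal_eqOn (hZ : Z.card ≤ k + 1) (r : ℝ → ℝ) :
    ∃ b : Fin (k + 1) → ℝ, EqOn (polyVal b) r Z := by
  have hdeg : (Lagrange.interpolate Z id r).degree < (k + 1 : ℕ) :=
    (Lagrange.degree_interpolate_lt r (injOn_id _)).trans_le (by exact_mod_cast hZ)
  have hnatDegree : (Lagrange.interpolate Z id r).natDegree ≤ k :=
    Polynomial.natDegree_le_iff_coeff_eq_zero.2 fun n hn =>
      Polynomial.coeff_eq_zero_of_degree_lt (hdeg.trans_le (by exact_mod_cast hn))
  have hofFn : Polynomial.ofFn (k + 1) (Polynomial.toFn (k + 1) (Lagrange.interpolate Z id r)) =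
      Lagrange.interpolate Z id r :=
    Polynomial.ofFn_comp_toFn_eq_id_of_natDegree_lt (Nat.lt_succ_of_le hnatDegree)
  refine ⟨Polynomial.toFn (k + 1) (Lagrange.interpolate Z id r), fun z hz => ?_⟩
  rw [polyVal_eq_eval_ofFn, hofFn]
  exact Lagrange.eval_interpolate_at_node (v := id) r (injOn_id _) hz

/-- The measure `(1 - f(x)) dx` on `[0,1]` is carried by the level sets of the distribution
function of `f` at the finitely many levels `Z`. -/
def IsCarriedByLevels (f : ℝ → ℝ) (Z : Finset ℝ) : Prop :=
  ∀ᵐ x, x ∈ Icc (0 : ℝ) 1 → distrib f x ∈ Z ∨ f x = 1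

theorem IsSublebesgue.isCarriedByLevels_polyZeros (hf : IsSublebesgue f) (ha : a ≠ 0)
    (hpos : ∀ y ∈ Icc 0 (distrib f 1), 0 ≤ polyVal a y)
    (hnull : momentFun (densities k f) a = 0) : IsCarriedByLevels f (polyZeros a) := by
  have hnonneg : 0 ≤ᵐ[volume.restrict (Ioc (0 : ℝ) 1)]
      fun x => polyVal a (distrib f x) * (1 - f x) := by
    filter_upwards [ae_restrict_mem measurableSet_Ioc] with x hx
    exact mul_nonneg (hpos _ (hf.distrib_mem (Ioc_subset_Icc_self hx)))
      (hf.one_sub.2 x (Ioc_subset_Icc_self hx)).1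
  rw [← hf.integral_polyVal, intervalIntegral.integral_eq_zero_iff_of_le_of_nonneg_ae zero_le_one
    hnonneg (hf.intervalIntegrable_comp_distrib_mul (continuous_polyVal_right a).continuousOn
      hf.one_sub), Measure.restrict_congr_set Ioc_ae_eq_Icc, EventuallyEq,
    ae_restrict_iff' measurableSet_Icc] at hnull
  filter_upwards [hnull] with x hx hxI
  rw [mem_polyZeros ha]
  exact (mul_eq_zero.1 (hx hxI)).imp_right fun h => (sub_eq_zero.1 h).symm

/-- The last point of `[0,1]` where the distribution function is at most `y`. -/
def lastLE (f : ℝ → ℝ) (y : ℝ) : ℝ := sSup {x | x ∈ Icc (0 : ℝ) 1 ∧ distrib f x ≤ y}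

theorem le_lastLE (hx : x ∈ Icc (0 : ℝ) 1) (hxy : distrib f x ≤ y) : x ≤ lastLE f y :=
  le_csSup ⟨1, fun _ h => h.1.2⟩ ⟨hx, hxy⟩

theorem IsSublebesgue.lastLE_mem (hf : IsSublebesgue f) (hy : 0 ≤ y) :
    lastLE f y ∈ Icc (0 : ℝ) 1 ∧ distrib f (lastLE f y) ≤ y :=
  (hf.continuousOn_distrib.preimage_isClosed_of_isClosed isClosed_Icc isClosed_Iic).csSup_mem
    ⟨0, by simp, (distrib_zero f).trans_le hy⟩ ⟨1, fun _ h => h.1.2⟩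

theorem IsSublebesgue.le_lastLE_iff (hf : IsSublebesgue f) (hy : 0 ≤ y)
    (hx : x ∈ Icc (0 : ℝ) 1) : x ≤ lastLE f y ↔ distrib f x ≤ y :=
  ⟨fun h => (hf.distrib_mono hx.1 h (hf.lastLE_mem hy).1.2).trans (hf.lastLE_mem hy).2,
    le_lastLE hx⟩

theorem IsSublebesgue.distrib_lastLE (hf : IsSublebesgue f) (hy : y ∈ Icc 0 (distrib f 1)) :
    distrib f (lastLE f y) = y := by
  obtain ⟨hmem, hle⟩ := hf.lastLE_mem hy.1
  obtain ⟨x, hx, rfl⟩ := hf.exists_distrib_eq hy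
  exact hle.antisymm (hf.distrib_mono hx.1 (le_lastLE hx le_rfl) hmem.2)

theorem IsSublebesgue.lastLE_eq_add (hf : IsSublebesgue f) (hy : y ∈ Icc 0 (distrib f 1)) :
    lastLE f y = y + ∫ x in (0 : ℝ)..lastLE f y, (1 - f x) := by
  have hdistrib : ∫ x in (0 : ℝ)..lastLE f y, f x = y := hf.distrib_lastLE hy
  rw [intervalIntegral.integral_sub intervalIntegrable_const
    (hf.intervalIntegrable (by simp) (hf.lastLE_mem hy.1).1), hdistrib]
  simp

theorem IsCarriedByLevels.integral_eq (hZ : IsCarriedByLevels f Z) (hf : IsSublebesgue f)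
    (hy : 0 ≤ y) {φ : ℝ → ℝ} (hφ : EqOn φ (indicator (Iic y) 1) Z) :
    ∫ x in (0 : ℝ)..1, φ (distrib f x) * (1 - f x) = ∫ x in (0 : ℝ)..lastLE f y, (1 - f x) := by
  rw [← intervalIntegral.integral_indicator (hf.lastLE_mem hy).1]
  refine intervalIntegral.integral_congr_ae ?_
  filter_upwards [hZ] with x hx hx01
  rw [uIoc_of_le zero_le_one] at hx01
  have hxI := Ioc_subset_Icc_self hx01
  rcases hx hxI with hlevel | hone
  · rw [hφ hlevel]
    simp only [indicator_apply, mem_Iic, mem_ofPred_eq, hf.le_lastLE_iff hy hxI, Pi.one_apply,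
      ite_mul, one_mul, zero_mul]
  · simp [indicator_apply, hone]

theorem distrib_le_of_lastLE_eq (hf : IsSublebesgue f) (hg : IsSublebesgue g)
    (h : ∀ y ∈ Icc 0 (distrib f 1), lastLE f y = lastLE g y) (hx : x ∈ Icc (0 : ℝ) 1) :
    distrib g x ≤ distrib f x := by
  have hmem := hf.distrib_mem hx
  rw [← hg.le_lastLE_iff hmem.1 hx, ← h _ hmem]
  exact le_lastLE hx le_rfl

/-- Interpolating the indicator functions of initial segments of the levels recovers the mass of
`(1 - f) dx` below each level from the moments, hence from the densities. -/
theorem sameMeasure_of_isCarriedByLevels (hf : IsSublebesgue f) (hg : IsSublebesgue g)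
    (hZ : Z.card ≤ k + 1) (hfZ : IsCarriedByLevels f Z) (hgZ : IsCarriedByLevels g Z)
    (hfg : densities k f = densities k g) : SameMeasure f g := by
  have h1 : distrib f 1 = distrib g 1 := by rw [hf.distrib_one k, hg.distrib_one k, hfg]
  have hlast : ∀ y ∈ Icc 0 (distrib f 1), lastLE f y = lastLE g y := by
    intro y hy
    obtain ⟨b, hb⟩ := exists_polyVal_eqOn hZ (indicator (Iic y) 1)
    rw [hf.lastLE_eq_add hy, hg.lastLE_eq_add (h1 ▸ hy), ← hfZ.integral_eq hf hy.1 hb,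
      ← hgZ.integral_eq hg hy.1 hb, hf.integral_polyVal, hg.integral_polyVal, hfg]
  exact sameMeasure_of_distrib_eq hf hg fun x hx =>
    (distrib_le_of_lastLE_eq hg hf (fun y hy => (hlast y (h1 ▸ hy)).symm) hx).antisymm
      (distrib_le_of_lastLE_eq hf hg hlast hx)

theorem IsSublebesgue.ae_eq_zero_of_distrib_eq (hf : IsSublebesgue f) {l r : ℝ} (hl : 0 ≤ l)
    (hr : r ≤ 1) (heq : distrib f l = distrib f r) : ∀ᵐ x, x ∈ Ioo l r → f x = 0 := by
  filter_upwards [hf.ae_hasDerivAt_distrib] with x hx hxlr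
  refine (hx ⟨hl.trans hxlr.1.le, hxlr.2.le.trans hr⟩).unique
    ((hasDerivAt_const x (distrib f l)).congr_of_eventuallyEq ?_)
  filter_upwards [Ioo_mem_nhds hxlr.1 hxlr.2] with y hy
  refine le_antisymm ?_ (hf.distrib_mono hl hy.1.le (hy.2.le.trans hr))
  rw [heq]
  exact hf.distrib_mono (hl.trans hy.1.le) hy.2.le hr

open scoped Classical in
/-- The levels in `Z` which the distribution function of `f` takes on a nondegenerate interval. -/
def flatLevels (f : ℝ → ℝ) (Z : Finset ℝ) : Finset ℝ :=
  {z ∈ Z | z ∈ Icc 0 (distrib f 1) ∧ invDistrib f z < lastLE f z}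

theorem mem_flatLevels :
    y ∈ flatLevels f Z ↔ y ∈ Z ∧ y ∈ Icc 0 (distrib f 1) ∧ invDistrib f y < lastLE f y :=
  Finset.mem_filter

theorem IsCarriedByLevels.sameMeasure_indicator (hZ : IsCarriedByLevels f Z)
    (hf : IsSublebesgue f) :
    SameMeasure f ((⋃ z ∈ flatLevels f Z, Ico (invDistrib f z) (lastLE f z))ᶜ.indicator 1) := by
  have hzero : ∀ᵐ x, ∀ z ∈ flatLevels f Z, x ∈ Ioo (invDistrib f z) (lastLE f z) → f x = 0 :=
    (ae_ball_iff (flatLevels f Z).countable_toSet).2 fun z hz => by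
      obtain ⟨-, hzI, -⟩ := mem_flatLevels.1 hz
      exact hf.ae_eq_zero_of_distrib_eq (hf.invDistrib_mem hzI).1.1 (hf.lastLE_mem hzI.1).1.2
        ((hf.distrib_invDistrib hzI).trans (hf.distrib_lastLE hzI).symm)
  have hends : ∀ᵐ x, ∀ z ∈ Z, x ≠ invDistrib f z ∧ x ≠ lastLE f z :=
    (ae_ball_iff Z.countable_toSet).2 fun z _ => (Measure.ae_ne volume _).and (Measure.ae_ne _ _)
  rw [SameMeasure, ae_restrict_iff' measurableSet_Icc]
  filter_upwards [hZ, hzero, hends] with x hx hx0 hxne hxI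
  by_cases hmem : x ∈ ⋃ z ∈ flatLevels f Z, Ico (invDistrib f z) (lastLE f z)
  · rw [indicator_of_notMem (notMem_compl_iff.2 hmem)]
    obtain ⟨z, hz, hxz⟩ := mem_iUnion₂.1 hmem
    exact hx0 z hz ⟨hxz.1.lt_of_ne' (hxne z (mem_flatLevels.1 hz).1).1, hxz.2⟩
  · rw [indicator_of_mem (mem_compl hmem)]
    refine (hx hxI).resolve_left fun hlevel => hmem ?_
    have hlo : invDistrib f (distrib f x) ≤ x := csInf_le ⟨0, fun _ h => h.1.1⟩ ⟨hxI, le_rfl⟩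
    have hhi : x < lastLE f (distrib f x) := (le_lastLE hxI le_rfl).lt_of_ne (hxne _ hlevel).2
    exact mem_iUnion₂.2 ⟨_, mem_flatLevels.2 ⟨hlevel, hf.distrib_mem hxI, hlo.trans_lt hhi⟩,
      hlo, hhi⟩

theorem IsCarriedByLevels.isZeroOneStep (hZ : IsCarriedByLevels f Z) (hf : IsSublebesgue f) :
    IsZeroOneStep f (fun i => invDistrib f ((flatLevels f Z).orderEmbOfFin rfl i))
      fun i => lastLE f ((flatLevels f Z).orderEmbOfFin rfl i) := by
  have hflat (i) := mem_flatLevels.1 ((flatLevels f Z).orderEmbOfFin_mem rfl i)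
  refine ⟨fun i => ⟨(hf.invDistrib_mem (hflat i).2.1).1.1, (hflat i).2.2,
    (hf.lastLE_mem (hflat i).2.1.1).1.2⟩, fun i j hij => ?_, ?_⟩
  · have hlast := hf.lastLE_mem (hflat i).2.1.1
    have hinv := hf.invDistrib_mem (hflat j).2.1
    by_contra! hle
    exact (((flatLevels f Z).orderEmbOfFin rfl).strictMono hij).not_ge
      (hinv.2.trans ((hf.distrib_mono hinv.1.1 hle hlast.1.2).trans hlast.2))
  · rw [← biUnion_range (f := (flatLevels f Z).orderEmbOfFin rfl)
      (g := fun z => Ico (invDistrib f z) (lastLE f z)), Finset.range_orderEmbOfFin]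
    exact hZ.sameMeasure_indicator hf

theorem one_lt_rootMultiplicity_of_nonneg {p : Polynomial ℝ} (hp : p ≠ 0) {u v z : ℝ}
    (hpos : ∀ y ∈ Icc u v, 0 ≤ p.eval y) (hz : z ∈ Ioo u v) (hroot : p.IsRoot z) :
    1 < p.rootMultiplicity z := by
  have hmin : IsLocalMin (fun y => p.eval y) z := by
    filter_upwards [Icc_mem_nhds hz.1 hz.2] with y hy
    rw [hroot.eq_zero]
    exact hpos y hy
  exact (Polynomial.one_lt_rootMultiplicity_iff_isRoot hp).2
    ⟨hroot, hmin.hasDerivAt_eq_zero (p.hasDerivAt z)⟩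

theorem sum_rootMultiplicity_le_natDegree {A : Type*} [CommRing A] [IsDomain A]
    (p : Polynomial A) (R : Finset A) : ∑ z ∈ R, p.rootMultiplicity z ≤ p.natDegree := by
  classical
  calc ∑ z ∈ R, p.rootMultiplicity z = ∑ z ∈ R, p.roots.count z := by
        simp only [Polynomial.count_roots]
    _ ≤ ∑ z ∈ R ∪ p.roots.toFinset, p.roots.count z :=
        Finset.sum_le_sum_of_subset Finset.subset_union_left
    _ = Multiset.card p.roots := Multiset.sum_count_eq_card fun z hz =>
        Finset.mem_union_right _ (Multiset.mem_toFinset.2 hz)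
    _ ≤ p.natDegree := p.card_roots'

/-- A nonnegative polynomial on `[u, v]` has only multiple roots inside `(u, v)`. -/
theorem two_mul_card_le_natDegree_add {p : Polynomial ℝ} (hp : p ≠ 0) {u v : ℝ}
    (hpos : ∀ y ∈ Icc u v, 0 ≤ p.eval y) {R : Finset ℝ} (hR : ∀ z ∈ R, z ∈ Icc u v ∧ p.IsRoot z) :
    2 * R.card ≤ p.natDegree + (R ∩ {u, v}).card := by
  have hmult : ∀ z ∈ R, 2 ≤ p.rootMultiplicity z + if z ∈ ({u, v} : Finset ℝ) then 1 else 0 := by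
    intro z hz
    obtain ⟨hzI, hroot⟩ := hR z hz
    split_ifs with hend
    · exact Nat.succ_le_succ ((Polynomial.rootMultiplicity_pos hp).2 hroot)
    · simp only [Finset.mem_insert, Finset.mem_singleton, not_or] at hend
      exact one_lt_rootMultiplicity_of_nonneg hp hpos
        ⟨hzI.1.lt_of_ne' hend.1, hzI.2.lt_of_ne hend.2⟩ hroot
  calc 2 * R.card = ∑ z ∈ R, 2 := by rw [Finset.sum_const, smul_eq_mul, mul_comm]
    _ ≤ ∑ z ∈ R, (p.rootMultiplicity z + if z ∈ ({u, v} : Finset ℝ) then 1 else 0) :=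
        Finset.sum_le_sum hmult
    _ = ∑ z ∈ R, p.rootMultiplicity z + (R ∩ {u, v}).card := by
        rw [Finset.sum_add_distrib, Finset.sum_ite_mem, Finset.card_eq_sum_ones]
    _ ≤ p.natDegree + (R ∩ {u, v}).card :=
        Nat.add_le_add_right (sum_rootMultiplicity_le_natDegree p R) _

theorem two_mul_card_flatLevels_le (ha : a ≠ 0)
    (hpos : ∀ y ∈ Icc 0 (distrib f 1), 0 ≤ polyVal a y) :
    2 * (flatLevels f (polyZeros a)).card ≤
      k + (flatLevels f (polyZeros a) ∩ {0, distrib f 1}).card := by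
  have hdeg : (Polynomial.ofFn (k + 1) a).natDegree ≤ k :=
    Nat.lt_succ_iff.1 (Polynomial.ofFn_natDegree_lt k.succ_pos a)
  refine (two_mul_card_le_natDegree_add (ofFn_ne_zero ha)
    (fun y hy => ?_) fun z hz => ?_).trans (Nat.add_le_add_right hdeg _)
  · rw [← polyVal_eq_eval_ofFn]
    exact hpos y hy
  · obtain ⟨hzero, hzI, -⟩ := mem_flatLevels.1 hz
    rw [Polynomial.IsRoot.def, ← polyVal_eq_eval_ofFn]
    exact ⟨hzI, (mem_polyZeros ha).1 hzero⟩

theorem IsSublebesgue.lastLE_distrib_one (hf : IsSublebesgue f) : lastLE f (distrib f 1) = 1 :=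
  (hf.lastLE_mem (hf.distrib_nonneg (by simp))).1.2.antisymm (le_lastLE (by simp) le_rfl)

theorem IsSublebesgue.exists_isZeroOneStep (hf : IsSublebesgue f) (ha : a ≠ 0)
    (hpos : ∀ y ∈ Icc 0 (distrib f 1), 0 ≤ polyVal a y)
    (hnull : momentFun (densities k f) a = 0) (hc : 0 < distrib f 1) :
    ∃ (n : ℕ) (s t : Fin n → ℝ), IsZeroOneStep f s t ∧ (n : ℝ) ≤ (k : ℝ) / 2 + 1 ∧
      ((n : ℝ) = (k : ℝ) / 2 + 1 → (∃ i, s i = 0) ∧ (∃ j, t j = 1)) := by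
  set R := flatLevels f (polyZeros a)
  have hcard : 2 * R.card ≤ k + (R ∩ {0, distrib f 1}).card := two_mul_card_flatLevels_le ha hpos
  have hpair : ({0, distrib f 1} : Finset ℝ).card = 2 := Finset.card_pair hc.ne
  have hcap : (R ∩ {0, distrib f 1}).card ≤ 2 :=
    (Finset.card_le_card Finset.inter_subset_right).trans hpair.le
  refine ⟨R.card, _, _, (hf.isCarriedByLevels_polyZeros ha hpos hnull).isZeroOneStep hf, ?_,
    fun heq => ?_⟩
  · have hle : (2 : ℝ) * R.card ≤ k + 2 := by exact_mod_cast hcard.trans (by lia)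
    linarith
  · have heq : 2 * R.card = k + 2 := by
      have : (2 : ℝ) * R.card = k + 2 := by rw [heq]; ring
      exact_mod_cast this
    have hsub : {0, distrib f 1} ⊆ R := Finset.inter_eq_right.1 <|
      Finset.eq_of_subset_of_card_le Finset.inter_subset_right (by lia)
    have hmem : ∀ z ∈ R, ∃ i, R.orderEmbOfFin rfl i = z := fun z hz => by
      rwa [← mem_range, Finset.range_orderEmbOfFin]
    obtain ⟨i, hi⟩ := hmem 0 (hsub (by simp))
    obtain ⟨j, hj⟩ := hmem (distrib f 1) (hsub (by simp))
    refine ⟨⟨i, ?_⟩, ⟨j, ?_⟩⟩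
    · rw [hi, invDistrib_zero]
    · rw [hj, hf.lastLE_distrib_one]

theorem IsSublebesgue.sameMeasure_zero (hf : IsSublebesgue f) (h : distrib f 1 = 0) :
    SameMeasure f 0 := by
  refine sameMeasure_of_distrib_eq hf ⟨measurable_const, fun x _ => by simp⟩ fun x hx => ?_
  have hmem := hf.distrib_mem hx
  rw [h, Icc_self, mem_singleton_iff] at hmem
  rw [hmem]
  simp [distrib]

theorem isZeroOneStep_of_sameMeasure_zero (h : SameMeasure f 0) :
    IsZeroOneStep f (fun _ : Fin 1 => 0) fun _ => 1 := by
  refine ⟨fun _ => by simp, fun i j hij => absurd (Subsingleton.elim i j) hij.ne, ?_⟩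
  filter_upwards [h, ae_restrict_of_ae (Measure.ae_ne volume 1),
    ae_restrict_mem measurableSet_Icc] with x hx hx1 hxI
  rw [indicator_of_notMem, hx, Pi.zero_apply]
  simpa using ⟨hxI.1, hxI.2.lt_of_ne hx1⟩

theorem frontier_feasible_spec (hδ : δ ∈ frontier (feasible k)) :
    (∃ f, IsSublebesgue f ∧ densities k f = δ) ∧
      (∀ f g, IsSublebesgue f → IsSublebesgue g → densities k f = δ → densities k g = δ →
        SameMeasure f g) ∧
      (∀ f, IsSublebesgue f → densities k f = δ →
        ∃ (n : ℕ) (s t : Fin n → ℝ), IsZeroOneStep f s t ∧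
          (n : ℝ) ≤ (k : ℝ) / 2 + 1 ∧
          ((n : ℝ) = (k : ℝ) / 2 + 1 → (∃ i, s i = 0) ∧ (∃ j, t j = 1))) := by
  rw [(isClosed_feasible k).frontier_eq, interior_feasible] at hδ
  have hdistrib : ∀ f, IsSublebesgue f → densities k f = δ → distrib f 1 = 1 - δ 0 :=
    fun f hf hd => by rw [← hd, hf.distrib_one k]
  refine ⟨mem_feasible.1 hδ.1, ?_⟩
  rcases (hδ.1.1 0).2.eq_or_lt with h1 | h1
  · have hzero : ∀ f, IsSublebesgue f → densities k f = δ → SameMeasure f 0 :=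
      fun f hf hd => hf.sameMeasure_zero (by rw [hdistrib f hf hd, h1, sub_self])
    refine ⟨fun f g hf hg hfd hgd => (hzero f hf hfd).trans (hzero g hg hgd).symm,
      fun f hf hd => ⟨1, _, _, isZeroOneStep_of_sameMeasure_zero (hzero f hf hd), ?_,
        fun _ => ⟨⟨0, rfl⟩, ⟨0, rfl⟩⟩⟩⟩
    rw [Nat.cast_one, le_add_iff_nonneg_left]
    positivity
  · obtain ⟨a, ha, hpos, hnull⟩ := exists_null_polyVal hδ.1 hδ.2 h1
    have hcarried : ∀ f, IsSublebesgue f → densities k f = δ →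
        IsCarriedByLevels f (polyZeros a) := fun f hf hd =>
      hf.isCarriedByLevels_polyZeros ha (by rwa [hdistrib f hf hd]) (by rwa [hd])
    refine ⟨fun f g hf hg hfd hgd => sameMeasure_of_isCarriedByLevels hf hg
      ((card_polyZeros_le a).trans k.le_succ) (hcarried f hf hfd) (hcarried g hg hgd)
      (hfd.trans hgd.symm), fun f hf hd => ?_⟩
    have hc := hdistrib f hf hd
    exact hf.exists_isZeroOneStep ha (by rwa [hc]) (by rwa [hd]) (by rwa [hc, sub_pos])

end Boundary

end

end PatternDensity

theorem mainTheorem4 (k : ℕ) :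
    -- entropy maximizers with densities in the interior of the feasible region
    (∀ δ ∈ interior (feasible k),
      (∃ f, IsLimitShape k δ f) ∧
      (∀ f g, IsLimitShape k δ f → IsLimitShape k δ g → SameMeasure f g) ∧
      (∀ f, IsLimitShape k δ f → ∃ p : NegPoly k, HasInverseSlope f p)) ∧
    -- the map from polynomials to densities
    (∃ Φ : NegPoly k ≃ₜ interior (feasible k), ∀ p : NegPoly k,
      (∃ f, IsSublebesgue f ∧ HasInverseSlope f p) ∧
      (∀ f, IsSublebesgue f → HasInverseSlope f p → densities k f = (Φ p : Fin (k + 1) → ℝ))) ∧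
    -- the boundary of the feasible region
    (∀ δ ∈ frontier (feasible k),
      (∃ f, IsSublebesgue f ∧ densities k f = δ) ∧
      (∀ f g, IsSublebesgue f → IsSublebesgue g → densities k f = δ → densities k g = δ →
        SameMeasure f g) ∧
      (∀ f, IsSublebesgue f → densities k f = δ →
        ∃ (n : ℕ) (s t : Fin n → ℝ), IsZeroOneStep f s t ∧
          (n : ℝ) ≤ (k : ℝ) / 2 + 1 ∧
          ((n : ℝ) = (k : ℝ) / 2 + 1 → (∃ i, s i = 0) ∧ (∃ j, t j = 1)))) :=
  ⟨fun _ hδ => limitShape_of_mem_momentInterior (interior_feasible_subset k hδ),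
    exists_homeomorph k,
    fun _ hδ => frontier_feasible_spec hδ⟩
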